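/- Let $0<a<\infty$. Let $L x=-\frac{d}{dt}\bigl((1-\frac{t^2}{a^2})\frac{dx}{dt}\bigr)+t^2x$ on $(-a,a)$. Let $\mathcal A$ be the set of functions $x:(-a,a)\to\mathbb C$ that are differentiable at every point and whose derivative is absolutely continuous on every compact subinterval of $(-a,a)$. Let $\mathcal L_{\max}$ be the operator in $L^2((-a,a))$ with domain $\{x\in L^2((-a,a))\cap\mathcal A: Lx\in L^2((-a,a))\}$ and action $\mathcal L_{\max}x=Lx$. Let $\mathcal L_{\min}$ be the closure of the restriction of $\mathcal L_{\max}$ to those $x$ in its domain whose support is a compact subset of $(-a,a)$. For $x$ in the domain of $\mathcal L_{\max}$ put $$b_{-a}(x)=\lim_{t\to-a+0}(t+a)x'(t),\qquad c_{-a}(x)=\lim_{t\to-a+0}\bigl((t+a)\ln(a+t)\,x'(t)-x(t)\bigr),$$ $$b_{a}(x)=\lim_{t\to a-0}(t-a)x'(t),\qquad c_{a}(x)=\lim_{t\to a-0}\bigl((t-a)\ln(a-t)\,x'(t)-x(t)\bigr).$$ For a complex $2\times2$ matrix $U=(u_{pq})$ let $\mathcal L_U$ be the restriction of $\mathcal L_{\max}$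 to those $x$ in its domain for which these four limits exist and satisfy $$(1+u_{11})\,b_{-a}(x)-i(1-u_{11})\,c_{-a}(x)+u_{12}\,b_a(x)+i u_{12}\,c_a(x)=0,$$ $$u_{21}\,b_{-a}(x)+i u_{21}\,c_{-a}(x)+(1+u_{22})\,b_a(x)-i(1-u_{22})\,c_a(x)=0.$$ **Theorem.** 1. If $U$ is unitary, then $\mathcal L_U$ is a self-adjoint operator in $L^2((-a,a))$, and $\mathcal L_{\min}\subset\mathcal L_U\subset\mathcal L_{\max}$ (both inclusions are proper). 2. Every self-adjoint operator $\mathcal L$ in $L^2((-a,a))$ that extends $\mathcal L_{\min}$ is of the form $\mathcal L=\mathcal L_U$ for some unitary $2\times 2$ matrix $U$. 3. For unitary $2\times2$ matrices $U_1,U_2$: $U_1=U_2$ if and only if $\mathcal L_{U_1}=\mathcal L_{U_2}$. -/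

import Mathlib

noncomputable section

open MeasureTheory Set Filter Topology

namespace Prolate

/-- Lebesgue measure on the open interval `(-a, a)`. -/
abbrev mu (a : ℝ) : Measure ℝ := volume.restrict (Ioo (-a) a)

/-- The Hilbert space `L²((-a, a))` of complex-valued functions. -/
abbrev H (a : ℝ) : Type := Lp ℂ 2 (mu a)

/-- The formal prolate spheroid operator
`(L x)(t) = -(d/dt) ((1 - t²/a²) dx/dt) + t² x(t)`. -/
def formalL (a : ℝ) (x : ℝ → ℂ) (t : ℝ) : ℂ :=
  -deriv (fun s : ℝ => ((1 - s ^ 2 / a ^ 2 : ℝ) : ℂ) * deriv x s) t + ((t ^ 2 : ℝ) : ℂ) * x t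

/-- The class `𝒜`: `x` is differentiable at every point of `(-a, a)`, and its derivative is
absolutely continuous on every compact subinterval of `(-a, a)`. A function on `(-a, a)` is
represented by a function on `ℝ`; its values outside `(-a, a)` play no role. -/
structure ClassA (a : ℝ) (x : ℝ → ℂ) : Prop where
  diff : ∀ t ∈ Ioo (-a) a, DifferentiableAt ℝ x t
  ac : ∀ α β : ℝ, -a < α → α ≤ β → β < a → AbsolutelyContinuousOnInterval (deriv x) α β

/-- The subclass of `𝒜` of functions whose support is a compact subset of `(-a, a)`. -/
structure ClassA₀ (a : ℝ) (x : ℝ → ℂ) : Prop extends ClassA a x where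
  supp : ∃ K : Set ℝ, IsCompact K ∧ K ⊆ Ioo (-a) a ∧ ∀ t ∈ Ioo (-a) a, t ∉ K → x t = 0

theorem ac_congr {f g : ℝ → ℂ} {α β : ℝ} (hf : AbsolutelyContinuousOnInterval f α β)
    (h : EqOn f g (uIcc α β)) : AbsolutelyContinuousOnInterval g α β := by
  rw [absolutelyContinuousOnInterval_iff] at hf ⊢
  intro ε hε
  obtain ⟨δ, hδ, H⟩ := hf ε hε
  refine ⟨δ, hδ, fun E hE hs => ?_⟩
  refine lt_of_eq_of_lt (Finset.sum_congr rfl fun i hi => ?_) (H E hE hs)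
  rw [h (hE.1 i hi).1, h (hE.1 i hi).2]

theorem ClassA.zero (a : ℝ) : ClassA a 0 :=
  ⟨fun _ _ => differentiableAt_const _, fun α β _ _ _ => by
    have h : deriv (0 : ℝ → ℂ) = fun _ => 0 := by ext t; simp
    rw [h, absolutelyContinuousOnInterval_iff]
    exact fun ε hε => ⟨1, one_pos, fun E _ _ => by simpa using hε⟩⟩

theorem ClassA.add {a : ℝ} {x y : ℝ → ℂ} (hx : ClassA a x) (hy : ClassA a y) :
    ClassA a (x + y) := by
  refine ⟨fun t ht => (hx.diff t ht).add (hy.diff t ht), fun α β h1 h2 h3 => ?_⟩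
  refine ac_congr ((hx.ac α β h1 h2 h3).add (hy.ac α β h1 h2 h3)) fun t ht => ?_
  rw [uIcc_of_le h2] at ht
  have ht' : t ∈ Ioo (-a) a := ⟨h1.trans_le ht.1, ht.2.trans_lt h3⟩
  rw [deriv_add (hx.diff t ht') (hy.diff t ht')]
  rfl

theorem ClassA.smul {a : ℝ} {x : ℝ → ℂ} (c : ℂ) (hx : ClassA a x) : ClassA a (c • x) := by
  refine ⟨fun t ht => (hx.diff t ht).const_smul c, fun α β h1 h2 h3 => ?_⟩
  refine ac_congr ((hx.ac α β h1 h2 h3).const_smul c) fun t ht => ?_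
  rw [uIcc_of_le h2] at ht
  have ht' : t ∈ Ioo (-a) a := ⟨h1.trans_le ht.1, ht.2.trans_lt h3⟩
  rw [deriv_const_smul c (hx.diff t ht')]

theorem ClassA.ae_differentiableAt {a : ℝ} {x : ℝ → ℂ} (hx : ClassA a x) :
    ∀ᵐ t ∂mu a, DifferentiableAt ℝ (deriv x) t := by
  rw [ae_restrict_iff' measurableSet_Ioo]
  have h : ∀ n : ℕ, ∀ᵐ t, t ∈ Icc (-a + 1 / ((n : ℝ) + 1)) (a - 1 / ((n : ℝ) + 1)) →
      DifferentiableAt ℝ (deriv x) t := by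
    intro n
    have hn : (0 : ℝ) < 1 / ((n : ℝ) + 1) := by positivity
    rcases le_or_gt (-a + 1 / ((n : ℝ) + 1)) (a - 1 / ((n : ℝ) + 1)) with hle | hlt
    · have := (hx.ac _ _ (by linarith) hle
        (by linarith)).boundedVariationOn.ae_differentiableAt_of_mem_uIcc
      rwa [uIcc_of_le hle] at this
    · exact Eventually.of_forall fun t ht => absurd (ht.1.trans ht.2) (not_le.2 hlt)
  filter_upwards [ae_all_iff.2 h] with t ht htI
  obtain ⟨n, hn⟩ := exists_nat_one_div_lt (lt_min (sub_pos.2 htI.1) (sub_pos.2 htI.2))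
  have h1 := hn.trans_le (min_le_left _ _)
  have h2 := hn.trans_le (min_le_right _ _)
  exact ht n ⟨by linarith, by linarith⟩

theorem formalL_congr {a : ℝ} {x y : ℝ → ℂ} (h : EqOn x y (Ioo (-a) a)) :
    EqOn (formalL a x) (formalL a y) (Ioo (-a) a) := by
  intro t ht
  have h1 : ∀ s ∈ Ioo (-a) a, deriv x s = deriv y s := fun s hs =>
    (h.eventuallyEq_of_mem (isOpen_Ioo.mem_nhds hs)).deriv_eq
  have h2 : (fun s : ℝ => ((1 - s ^ 2 / a ^ 2 : ℝ) : ℂ) * deriv x s) =ᶠ[𝓝 t]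
      fun s : ℝ => ((1 - s ^ 2 / a ^ 2 : ℝ) : ℂ) * deriv y s := by
    filter_upwards [isOpen_Ioo.mem_nhds ht] with s hs
    rw [h1 s hs]
  simp only [formalL, h2.deriv_eq, h ht]

theorem differentiableAt_flux (a : ℝ) {x : ℝ → ℂ} {t : ℝ}
    (h : DifferentiableAt ℝ (deriv x) t) :
    DifferentiableAt ℝ (fun s : ℝ => ((1 - s ^ 2 / a ^ 2 : ℝ) : ℂ) * deriv x s) t := by
  refine DifferentiableAt.mul ?_ h
  have : DifferentiableAt ℝ (fun s : ℝ => 1 - s ^ 2 / a ^ 2) t := by fun_prop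
  exact this.hasDerivAt.ofReal_comp.differentiableAt

theorem formalL_add {a : ℝ} {x y : ℝ → ℂ} (hx : ClassA a x) (hy : ClassA a y) :
    formalL a (x + y) =ᵐ[mu a] formalL a x + formalL a y := by
  filter_upwards [hx.ae_differentiableAt, hy.ae_differentiableAt,
    ae_restrict_mem measurableSet_Ioo] with t h1 h2 ht
  have h3 : (fun s : ℝ => ((1 - s ^ 2 / a ^ 2 : ℝ) : ℂ) * deriv (x + y) s) =ᶠ[𝓝 t]
      fun s : ℝ => ((1 - s ^ 2 / a ^ 2 : ℝ) : ℂ) * deriv x s +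
        ((1 - s ^ 2 / a ^ 2 : ℝ) : ℂ) * deriv y s := by
    filter_upwards [isOpen_Ioo.mem_nhds ht] with s hs
    rw [deriv_add (hx.diff s hs) (hy.diff s hs)]
    ring
  simp only [formalL, Pi.add_apply, h3.deriv_eq]
  rw [deriv_fun_add (differentiableAt_flux a h1) (differentiableAt_flux a h2)]
  ring

theorem formalL_smul {a : ℝ} {x : ℝ → ℂ} (c : ℂ) (hx : ClassA a x) :
    formalL a (c • x) =ᵐ[mu a] c • formalL a x := by
  filter_upwards [hx.ae_differentiableAt, ae_restrict_mem measurableSet_Ioo] with t h1 ht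
  have h3 : (fun s : ℝ => ((1 - s ^ 2 / a ^ 2 : ℝ) : ℂ) * deriv (c • x) s) =ᶠ[𝓝 t]
      fun s : ℝ => c • (((1 - s ^ 2 / a ^ 2 : ℝ) : ℂ) * deriv x s) := by
    filter_upwards [isOpen_Ioo.mem_nhds ht] with s hs
    rw [deriv_const_smul c (hx.diff s hs)]
    simp only [smul_eq_mul]
    ring
  simp only [formalL, Pi.smul_apply, h3.deriv_eq]
  rw [deriv_fun_const_smul c (differentiableAt_flux a h1)]
  simp only [smul_eq_mul]
  ring

/-- The graph of the maximal operator: the pairs `(x, L x)` in `L² × L²` with `x ∈ 𝒜`. -/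
def maxGraph (a : ℝ) : Submodule ℂ (H a × H a) where
  carrier := {p | ∃ x : ℝ → ℂ, ClassA a x ∧ p.1 =ᵐ[mu a] x ∧ p.2 =ᵐ[mu a] formalL a x}
  zero_mem' := by
    refine ⟨0, ClassA.zero a, Lp.coeFn_zero _ _ _, ?_⟩
    have h : formalL a 0 = 0 := by ext t; simp [formalL]
    rw [h]
    exact Lp.coeFn_zero _ _ _
  add_mem' := by
    rintro ⟨u, v⟩ ⟨u', v'⟩ ⟨x, hx, h1, h2⟩ ⟨y, hy, h3, h4⟩
    exact ⟨x + y, hx.add hy, (Lp.coeFn_add _ _).trans (h1.add h3),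
      (Lp.coeFn_add _ _).trans ((h2.add h4).trans (formalL_add hx hy).symm)⟩
  smul_mem' := by
    rintro c ⟨u, v⟩ ⟨x, hx, h1, h2⟩
    exact ⟨c • x, hx.smul c, (Lp.coeFn_smul _ _).trans (h1.const_smul c),
      (Lp.coeFn_smul _ _).trans ((h2.const_smul c).trans (formalL_smul c hx).symm)⟩

/-- The maximal operator: its domain consists of the `x ∈ L² ∩ 𝒜` with `L x ∈ L²`, and it acts
by `x ↦ L x`. -/
def Lmax (a : ℝ) : H a →ₗ.[ℂ] H a := (maxGraph a).toLinearPMap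

theorem ClassA.eqOn_of_ae {a : ℝ} {x y : ℝ → ℂ} (hx : ClassA a x) (hy : ClassA a y)
    (h : x =ᵐ[mu a] y) : EqOn x y (Ioo (-a) a) :=
  Measure.eqOn_open_of_ae_eq h isOpen_Ioo
    (fun t ht => (hx.diff t ht).continuousAt.continuousWithinAt)
    (fun t ht => (hy.diff t ht).continuousAt.continuousWithinAt)

/-- `maxGraph` is the graph of a single-valued operator, so that it is the graph of `Lmax`. -/
theorem graph_Lmax (a : ℝ) : (Lmax a).graph = maxGraph a := by
  refine Submodule.toLinearPMap_graph_eq _ ?_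
  rintro ⟨u, v⟩ ⟨x, hx, h1, h2⟩ (h0 : u = 0)
  subst h0
  have h3 : EqOn x 0 (Ioo (-a) a) :=
    hx.eqOn_of_ae (ClassA.zero a) (h1.symm.trans (Lp.coeFn_zero _ _ _))
  refine Lp.ext (h2.trans ?_)
  refine EventuallyEq.trans ?_ (Lp.coeFn_zero _ _ _).symm
  filter_upwards [ae_restrict_mem measurableSet_Ioo] with t ht
  rw [formalL_congr h3 ht]
  simp [formalL]

/-- The classes in `L²` of the functions of `ClassA₀`. -/
def coreDomain (a : ℝ) : Submodule ℂ (H a) where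
  carrier := {u | ∃ x : ℝ → ℂ, ClassA₀ a x ∧ u =ᵐ[mu a] x}
  zero_mem' := ⟨0, ⟨ClassA.zero a, ∅, isCompact_empty, empty_subset _, fun _ _ _ => rfl⟩,
    Lp.coeFn_zero _ _ _⟩
  add_mem' := by
    rintro u v ⟨x, ⟨hx, K, hK, hKI, hxK⟩, h1⟩ ⟨y, ⟨hy, K', hK', hKI', hyK⟩, h2⟩
    refine ⟨x + y, ⟨hx.add hy, K ∪ K', hK.union hK', union_subset hKI hKI', fun t ht htK => ?_⟩,
      (Lp.coeFn_add _ _).trans (h1.add h2)⟩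
    rw [mem_union, not_or] at htK
    rw [Pi.add_apply, hxK t ht htK.1, hyK t ht htK.2, add_zero]
  smul_mem' := by
    rintro c u ⟨x, ⟨hx, K, hK, hKI, hxK⟩, h1⟩
    refine ⟨c • x, ⟨hx.smul c, K, hK, hKI, fun t ht htK => ?_⟩,
      (Lp.coeFn_smul _ _).trans (h1.const_smul c)⟩
    rw [Pi.smul_apply, hxK t ht htK, smul_zero]

/-- The restriction of `Lmax` to the functions with compact support in `(-a, a)`. -/
def Lcore (a : ℝ) : H a →ₗ.[ℂ] H a := (Lmax a).domRestrict (coreDomain a)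

/-- The minimal operator: the closure of `Lcore`. -/
def Lmin (a : ℝ) : H a →ₗ.[ℂ] H a := (Lcore a).closure

/-- `bm, cm, bp, cp` are the generalized boundary values `b₋ₐ(x), c₋ₐ(x), bₐ(x), cₐ(x)`.
The limits are one-sided: `t` tends to the endpoint inside `(-a, a)`. -/
structure HasBoundaryValues (a : ℝ) (x : ℝ → ℂ) (bm cm bp cp : ℂ) : Prop where
  bm_lim : Tendsto (fun t : ℝ => ((t + a : ℝ) : ℂ) * deriv x t) (𝓝[Ioo (-a) a] (-a)) (𝓝 bm)
  cm_lim : Tendsto (fun t : ℝ => (((t + a) * Real.log (a + t) : ℝ) : ℂ) * deriv x t - x t)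
    (𝓝[Ioo (-a) a] (-a)) (𝓝 cm)
  bp_lim : Tendsto (fun t : ℝ => ((t - a : ℝ) : ℂ) * deriv x t) (𝓝[Ioo (-a) a] a) (𝓝 bp)
  cp_lim : Tendsto (fun t : ℝ => (((t - a) * Real.log (a - t) : ℝ) : ℂ) * deriv x t - x t)
    (𝓝[Ioo (-a) a] a) (𝓝 cp)

/-- The two boundary conditions determined by the matrix `U`. -/
def BoundaryCondition (U : Matrix (Fin 2) (Fin 2) ℂ) (bm cm bp cp : ℂ) : Prop :=
  (1 + U 0 0) * bm - Complex.I * (1 - U 0 0) * cm + U 0 1 * bp + Complex.I * U 0 1 * cp = 0 ∧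
  U 1 0 * bm + Complex.I * U 1 0 * cm + (1 + U 1 1) * bp - Complex.I * (1 - U 1 1) * cp = 0

theorem HasBoundaryValues.zero (a : ℝ) : HasBoundaryValues a 0 0 0 0 0 := by
  constructor <;> simp [tendsto_const_nhds]

theorem HasBoundaryValues.add {a : ℝ} {x y : ℝ → ℂ} (hx : ClassA a x) (hy : ClassA a y)
    {bm cm bp cp bm' cm' bp' cp' : ℂ} (h : HasBoundaryValues a x bm cm bp cp)
    (h' : HasBoundaryValues a y bm' cm' bp' cp') :
    HasBoundaryValues a (x + y) (bm + bm') (cm + cm') (bp + bp') (cp + cp') := by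
  have hd : ∀ t ∈ Ioo (-a) a, deriv (x + y) t = deriv x t + deriv y t := fun t ht =>
    deriv_add (hx.diff t ht) (hy.diff t ht)
  constructor
  · refine (h.bm_lim.add h'.bm_lim).congr' ?_
    filter_upwards [self_mem_nhdsWithin] with t ht
    rw [hd t ht]; ring
  · refine (h.cm_lim.add h'.cm_lim).congr' ?_
    filter_upwards [self_mem_nhdsWithin] with t ht
    rw [hd t ht, Pi.add_apply]; ring
  · refine (h.bp_lim.add h'.bp_lim).congr' ?_
    filter_upwards [self_mem_nhdsWithin] with t ht
    rw [hd t ht]; ring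
  · refine (h.cp_lim.add h'.cp_lim).congr' ?_
    filter_upwards [self_mem_nhdsWithin] with t ht
    rw [hd t ht, Pi.add_apply]; ring

theorem HasBoundaryValues.smul {a : ℝ} {x : ℝ → ℂ} (c : ℂ) (hx : ClassA a x)
    {bm cm bp cp : ℂ} (h : HasBoundaryValues a x bm cm bp cp) :
    HasBoundaryValues a (c • x) (c * bm) (c * cm) (c * bp) (c * cp) := by
  have hd : ∀ t ∈ Ioo (-a) a, deriv (c • x) t = c * deriv x t := fun t ht =>
    deriv_const_smul c (hx.diff t ht)
  constructor
  · refine (h.bm_lim.const_mul c).congr' ?_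
    filter_upwards [self_mem_nhdsWithin] with t ht
    rw [hd t ht]; ring
  · refine (h.cm_lim.const_mul c).congr' ?_
    filter_upwards [self_mem_nhdsWithin] with t ht
    rw [hd t ht, Pi.smul_apply, smul_eq_mul]; ring
  · refine (h.bp_lim.const_mul c).congr' ?_
    filter_upwards [self_mem_nhdsWithin] with t ht
    rw [hd t ht]; ring
  · refine (h.cp_lim.const_mul c).congr' ?_
    filter_upwards [self_mem_nhdsWithin] with t ht
    rw [hd t ht, Pi.smul_apply, smul_eq_mul]; ring

/-- The functions of class `𝒜` whose generalized boundary values exist and satisfy the boundary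
conditions determined by `U`. -/
def boundaryDomain (a : ℝ) (U : Matrix (Fin 2) (Fin 2) ℂ) : Submodule ℂ (H a) where
  carrier := {u | ∃ x : ℝ → ℂ, ClassA a x ∧ u =ᵐ[mu a] x ∧ ∃ bm cm bp cp : ℂ,
    HasBoundaryValues a x bm cm bp cp ∧ BoundaryCondition U bm cm bp cp}
  zero_mem' := ⟨0, ClassA.zero a, Lp.coeFn_zero _ _ _, 0, 0, 0, 0, HasBoundaryValues.zero a,
    by simp [BoundaryCondition]⟩
  add_mem' := by
    rintro u v ⟨x, hx, h1, bm, cm, bp, cp, hb, hU⟩ ⟨y, hy, h2, bm', cm', bp', cp', hb', hU'⟩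
    refine ⟨x + y, hx.add hy, (Lp.coeFn_add _ _).trans (h1.add h2), _, _, _, _,
      hb.add hx hy hb', ?_, ?_⟩
    · linear_combination hU.1 + hU'.1
    · linear_combination hU.2 + hU'.2
  smul_mem' := by
    rintro c u ⟨x, hx, h1, bm, cm, bp, cp, hb, hU⟩
    refine ⟨c • x, hx.smul c, (Lp.coeFn_smul _ _).trans (h1.const_smul c), _, _, _, _,
      hb.smul c hx, ?_, ?_⟩
    · linear_combination c * hU.1
    · linear_combination c * hU.2

/-- The operator `L_U`: the restriction of `Lmax` by the boundary conditions determined by `U`. -/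
def LU (a : ℝ) (U : Matrix (Fin 2) (Fin 2) ℂ) : H a →ₗ.[ℂ] H a :=
  (Lmax a).domRestrict (boundaryDomain a U)

end Prolate

end

/-
The endpoints are regular singular, and both `1` and the logarithmic solution of
`((1 - t² / a²) y')' = 0` are square integrable there (the limit circle case), so the Wronskians of
a function of the maximal domain with these two solutions have limits; these limits are, up to
constants, the boundary values `b` and `c`. Green's identity expresses the failure of the maximal
operator to be symmetric through them, and in terms of `Γ₁ = b + i c` and `Γ₂ = i c - b` the
boundary form is a multiple of `⟪Γ₂, Γ₂⟫ - ⟪Γ₁, Γ₁⟫`. The pair `(Γ₁, Γ₂)` takes all values in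
`ℂ² × ℂ²`, so self-adjoint extensions correspond to the subspaces of `ℂ² × ℂ²` that equal their own
orthogonal complement for this form, and these are the graphs `Γ₂ = U Γ₁` of the unitary matrices.
That the maximal operator is the adjoint of its restriction to compactly supported functions is a
du Bois-Reymond argument: a weak solution of `Lx = v` differs from an explicit primitive of the
equation by a solution of `((1 - t² / a²) y')' = 0`.
-/

noncomputable section

open MeasureTheory Set Filter Topology
open scoped InnerProductSpace LinearPMap ContDiff ComplexConjugate

namespace Prolate

section BoundaryTriplets

variable {𝕜 : Type*} [RCLike 𝕜]

section PartialMaps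

variable {E : Type*} [NormedAddCommGroup E] [InnerProductSpace 𝕜 E]

theorem le_of_le_of_domain_le {A B T : E →ₗ.[𝕜] E} (hA : A ≤ T) (hB : B ≤ T)
    (h : A.domain ≤ B.domain) : A ≤ B :=
  ⟨h, fun u v huv => (hA.2 (huv.trans rfl : (u : E) = (⟨v, hB.1 v.2⟩ : T.domain))).trans
    (hB.2 rfl).symm⟩

theorem closure_le_of_le {A B : E →ₗ.[𝕜] E} (h : A ≤ B) (hB : B.IsClosed) : A.closure ≤ B := by
  have hBc : B.closure = B := LinearPMap.eq_of_eq_graph <| by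
    rw [← hB.isClosable.graph_closure_eq_closure_graph]
    exact IsClosed.submodule_topologicalClosure_eq hB
  exact hBc ▸ hB.isClosable.closure_mono h

theorem adjoint_anti [CompleteSpace E] {A B : E →ₗ.[𝕜] E} (hA : Dense (A.domain : Set E))
    (h : A ≤ B) : B† ≤ A† := by
  have hB : Dense (B.domain : Set E) := hA.mono h.1
  refine LinearPMap.IsFormalAdjoint.le_adjoint hA fun u v => ?_
  rw [h.2 (y := ⟨u, h.1 u.2⟩) rfl]
  exact (LinearPMap.adjoint_isFormalAdjoint hB).symm _ v

theorem dense_domain_of_maximal [CompleteSpace E] {S T : E →ₗ.[𝕜] E}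
    (h : ∀ u v : E, (∀ w : S.domain, ⟪S w, u⟫_𝕜 = ⟪(w : E), v⟫_𝕜) → (u, v) ∈ T.graph) :
    Dense (S.domain : Set E) := by
  rw [Submodule.dense_iff_topologicalClosure_eq_top, Submodule.topologicalClosure_eq_top_iff,
    Submodule.eq_bot_iff]
  intro v hv
  have h0v : ((0 : E), v) ∈ T.graph := h 0 v fun w => by rw [inner_zero_right, hv w w.2]
  exact LinearPMap.graph_fst_eq_zero_snd T h0v rfl

theorem adjoint_eq_of_maximal [CompleteSpace E] {S T : E →ₗ.[𝕜] E} (hST : S.IsFormalAdjoint T)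
    (h : ∀ u v : E, (∀ w : S.domain, ⟪S w, u⟫_𝕜 = ⟪(w : E), v⟫_𝕜) → (u, v) ∈ T.graph) :
    S† = T := by
  have hS := dense_domain_of_maximal h
  refine le_antisymm (LinearPMap.le_of_le_graph ?_) (hST.le_adjoint hS)
  rintro ⟨u, v⟩ huv
  obtain ⟨u, rfl, rfl⟩ := (LinearPMap.mem_graph_iff _).1 huv
  exact h _ _ fun w => (LinearPMap.adjoint_isFormalAdjoint hS).symm w u

end PartialMaps

section KreinForm

variable {K : Type*} [NormedAddCommGroup K] [InnerProductSpace 𝕜 K]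

/-- The orthogonal complement of `V` for the indefinite form `⟪q.2, p.2⟫ - ⟪q.1, p.1⟫` on `K × K`.
Its Lagrangian subspaces, those equal to their own complement, parametrize the self-adjoint
extensions of a symmetric operator. -/
def kreinOrthogonal (V : Submodule 𝕜 (K × K)) : Submodule 𝕜 (K × K) where
  carrier := {p | ∀ q ∈ V, ⟪q.2, p.2⟫_𝕜 = ⟪q.1, p.1⟫_𝕜}
  zero_mem' q _ := by simp only [Prod.fst_zero, Prod.snd_zero, inner_zero_right]
  add_mem' hp hp' q hq := by
    simp only [Prod.fst_add, Prod.snd_add, inner_add_right, hp q hq, hp' q hq]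
  smul_mem' c p hp q hq := by
    simp only [Prod.smul_fst, Prod.smul_snd, inner_smul_right, hp q hq]

theorem kreinOrthogonal_top : kreinOrthogonal (⊤ : Submodule 𝕜 (K × K)) = ⊥ := by
  refine (Submodule.eq_bot_iff _).2 fun p hp => ?_
  have h₁ : ⟪p.1, p.1⟫_𝕜 = 0 := by simpa using (hp (p.1, 0) trivial).symm
  have h₂ : ⟪p.2, p.2⟫_𝕜 = 0 := by simpa using hp (0, p.2) trivial
  exact Prod.ext (inner_self_eq_zero.1 h₁) (inner_self_eq_zero.1 h₂)

theorem isClosed_kreinOrthogonal (V : Submodule 𝕜 (K × K)) :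
    IsClosed (kreinOrthogonal V : Set (K × K)) := by
  have hV : (kreinOrthogonal V : Set (K × K)) =
      ⋂ q ∈ V, {p | ⟪q.2, p.2⟫_𝕜 = ⟪q.1, p.1⟫_𝕜} := by
    ext p
    simp only [mem_iInter]
    rfl
  rw [hV]
  exact isClosed_biInter fun q _ => isClosed_eq (by fun_prop) (by fun_prop)

theorem bot_lt_graph [Nontrivial K] (f : K →ₗ[𝕜] K) : ⊥ < f.graph := by
  obtain ⟨x, hx⟩ := exists_ne (0 : K)
  exact bot_lt_iff_ne_bot.2 fun h =>
    hx (congrArg Prod.fst ((Submodule.eq_bot_iff _).1 h (x, f x) ((f.mem_graph_iff _).2 rfl)))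

theorem graph_lt_top [Nontrivial K] (f : K →ₗ[𝕜] K) : f.graph < ⊤ := by
  obtain ⟨x, hx⟩ := exists_ne (0 : K)
  refine lt_top_iff_ne_top.2 fun h => hx ?_
  have h0x : (0, x) ∈ f.graph := h ▸ Submodule.mem_top
  exact ((f.mem_graph_iff _).1 h0x).trans f.map_zero

theorem graph_injective {R M N : Type*} [Semiring R] [AddCommMonoid M] [Module R M]
    [AddCommMonoid N] [Module R N] : Function.Injective (LinearMap.graph : (M →ₗ[R] N) → _) :=
  fun f g h => LinearMap.ext fun x =>
    (g.mem_graph_iff (x, f x)).1 (h ▸ (f.mem_graph_iff _).2 rfl)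

theorem surjective_of_forall_inner_eq_zero {V : Type*} [NormedAddCommGroup V] [NormedSpace 𝕜 V]
    [CompleteSpace V] (e : V →ₗᵢ[𝕜] K) (h : ∀ z, (∀ v, ⟪e v, z⟫_𝕜 = 0) → z = 0) :
    Function.Surjective e := by
  have hcomplete : IsComplete (LinearMap.range e.toLinearMap : Set K) := by
    rw [LinearMap.coe_range]
    exact e.isometry.isUniformInducing.isComplete_range
  have : CompleteSpace (LinearMap.range e.toLinearMap) := hcomplete.completeSpace_coe
  refine LinearMap.range_eq_top.1 (Submodule.orthogonal_eq_bot_iff.1 ?_)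
  refine (Submodule.eq_bot_iff _).2 fun z hz => h z fun v => hz _ ⟨v, rfl⟩

variable [CompleteSpace K]

theorem kreinOrthogonal_graph_of_mem_unitary {U : K →L[𝕜] K} (hU : U ∈ unitary (K →L[𝕜] K)) :
    kreinOrthogonal (U : K →ₗ[𝕜] K).graph = (U : K →ₗ[𝕜] K).graph := by
  obtain ⟨e, rfl⟩ : ∃ e : K ≃ₗᵢ[𝕜] K, (e : K →L[𝕜] K) = U :=
    ⟨Unitary.linearIsometryEquiv ⟨U, hU⟩, rfl⟩
  ext p
  constructor
  · refine fun hp => ext_inner_left 𝕜 fun y => ?_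
    have hy : ⟪y, p.2⟫_𝕜 = ⟪e.symm y, p.1⟫_𝕜 := hp (e.symm y, y) (e.apply_symm_apply y).symm
    rw [hy, ← e.inner_map_map, e.apply_symm_apply]
    rfl
  · rintro (hp : p.2 = e p.1) q (hq : q.2 = e q.1)
    rw [hp, hq, e.inner_map_map]

theorem exists_mem_unitary_graph_eq {V : Submodule 𝕜 (K × K)} (hV : kreinOrthogonal V = V) :
    ∃ U ∈ unitary (K →L[𝕜] K), (U : K →ₗ[𝕜] K).graph = V := by
  have hmem {p : K × K} : p ∈ V ↔ ∀ q ∈ V, ⟪q.2, p.2⟫_𝕜 = ⟪q.1, p.1⟫_𝕜 := by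
    conv_lhs => rw [← hV]
    rfl
  have : CompleteSpace V :=
    (hV ▸ isClosed_kreinOrthogonal V : IsClosed (V : Set (K × K))).completeSpace_coe
  have hnorm {p : K × K} (hp : p ∈ V) : ‖p.2‖ = ‖p.1‖ := by
    rw [@norm_eq_sqrt_re_inner 𝕜, hmem.1 hp p hp, ← norm_eq_sqrt_re_inner]
  -- `K × K` carries the sup norm, for which both projections of `V` are therefore isometries.
  let e₁ : V →ₗᵢ[𝕜] K := ⟨LinearMap.fst 𝕜 K K ∘ₗ V.subtype, fun p =>
    ((max_eq_left (hnorm p.2).le).symm : _ = max _ _)⟩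
  let e₂ : V →ₗᵢ[𝕜] K := ⟨LinearMap.snd 𝕜 K K ∘ₗ V.subtype, fun p =>
    ((max_eq_right (hnorm p.2).ge).symm : _ = max _ _)⟩
  have h₁ : Function.Surjective e₁ := surjective_of_forall_inner_eq_zero e₁ fun z hz => by
    have hzV : (z, (0 : K)) ∈ V := hmem.2 fun q hq => by
      rw [inner_zero_right]
      exact (hz ⟨q, hq⟩).symm
    simpa using (hnorm hzV).symm
  have h₂ : Function.Surjective e₂ := surjective_of_forall_inner_eq_zero e₂ fun z hz => by
    have hzV : ((0 : K), z) ∈ V := hmem.2 fun q hq => by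
      rw [inner_zero_right]
      exact hz ⟨q, hq⟩
    simpa using hnorm hzV
  let U : K ≃ₗᵢ[𝕜] K :=
    (LinearIsometryEquiv.ofSurjective e₁ h₁).symm.trans (LinearIsometryEquiv.ofSurjective e₂ h₂)
  have hU (p : V) : U (p : K × K).1 = (p : K × K).2 :=
    congrArg e₂ ((LinearIsometryEquiv.ofSurjective e₁ h₁).symm_apply_apply p)
  refine ⟨_, (Unitary.linearIsometryEquiv.symm U).2, ?_⟩
  ext p
  rw [LinearMap.mem_graph_iff]
  change p.2 = U p.1 ↔ p ∈ V
  constructor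
  · obtain ⟨q, hq⟩ := h₁ p.1
    intro hp
    have : (q : K × K) = p := Prod.ext hq (by rw [hp, ← hU q]; exact congrArg U hq)
    exact this ▸ q.2
  · exact fun hp => (hU ⟨p, hp⟩).symm

end KreinForm

variable {E : Type*} [NormedAddCommGroup E] [InnerProductSpace 𝕜 E] [CompleteSpace E]

/-- A boundary triplet for a densely defined symmetric operator `S` with adjoint `T`: a linear map
of the domain of `T` onto `K × K` whose two components `Γ₁, Γ₂` express the failure of `T` to be
symmetric through the form `⟪Γ₂ u, Γ₂ v⟫ - ⟪Γ₁ u, Γ₁ v⟫`. -/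
structure BoundaryTriplet (S T : E →ₗ.[𝕜] E) (K : Type*) [NormedAddCommGroup K]
    [InnerProductSpace 𝕜 K] where
  dense_domain : Dense (S.domain : Set E)
  le : S ≤ T
  adjoint_eq : S† = T
  boundaryMap : T.domain →ₗ[𝕜] K × K
  surjective : Function.Surjective boundaryMap
  scale : 𝕜
  scale_ne_zero : scale ≠ 0
  green : ∀ u v : T.domain, ⟪T u, (v : E)⟫_𝕜 - ⟪(u : E), T v⟫_𝕜 =
    scale * (⟪(boundaryMap u).2, (boundaryMap v).2⟫_𝕜 - ⟪(boundaryMap u).1, (boundaryMap v).1⟫_𝕜)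

namespace BoundaryTriplet

variable {K : Type*} [NormedAddCommGroup K] [InnerProductSpace 𝕜 K] {S T A : E →ₗ.[𝕜] E}
  (Γ : BoundaryTriplet S T K)

/-- The restriction of `T` to the vectors whose boundary data lie in `V`. -/
def extension (V : Submodule 𝕜 (K × K)) : E →ₗ.[𝕜] E :=
  T.domRestrict ((V.comap Γ.boundaryMap).map T.domain.subtype)

/-- The boundary data of the vectors in the domain of `A`. -/
def boundarySpace (A : E →ₗ.[𝕜] E) : Submodule 𝕜 (K × K) :=
  (A.domain.comap T.domain.subtype).map Γ.boundaryMap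

theorem extension_le (V : Submodule 𝕜 (K × K)) : Γ.extension V ≤ T :=
  LinearPMap.domRestrict_le

theorem coe_mem_extension_domain {V : Submodule 𝕜 (K × K)} {u : T.domain} :
    (u : E) ∈ (Γ.extension V).domain ↔ Γ.boundaryMap u ∈ V := by
  simp [extension]

theorem boundaryMap_mem_boundarySpace {u : T.domain} (hu : (u : E) ∈ A.domain) :
    Γ.boundaryMap u ∈ Γ.boundarySpace A :=
  Submodule.mem_map_of_mem hu

theorem boundarySpace_extension (V : Submodule 𝕜 (K × K)) :
    Γ.boundarySpace (Γ.extension V) = V := by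
  have h : (Γ.extension V).domain.comap T.domain.subtype = V.comap Γ.boundaryMap :=
    Submodule.ext fun _ => Γ.coe_mem_extension_domain
  rw [boundarySpace, h, Submodule.map_comap_eq_of_surjective Γ.surjective]

theorem extension_injective : Function.Injective Γ.extension :=
  Function.LeftInverse.injective Γ.boundarySpace_extension

theorem extension_mono {V W : Submodule 𝕜 (K × K)} (h : V ≤ W) :
    Γ.extension V ≤ Γ.extension W :=
  le_of_le_of_domain_le (Γ.extension_le V) (Γ.extension_le W) fun u hu =>
    (Γ.coe_mem_extension_domain (u := ⟨u, hu.2⟩)).2 (h (Γ.coe_mem_extension_domain.1 hu))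

theorem extension_strictMono : StrictMono Γ.extension :=
  Monotone.strictMono_of_injective (fun _ _ => Γ.extension_mono) Γ.extension_injective

theorem extension_top : Γ.extension ⊤ = T :=
  LinearPMap.eq_of_le_of_domain_eq (Γ.extension_le ⊤) <| (Γ.extension_le ⊤).1.antisymm fun u hu =>
    (Γ.coe_mem_extension_domain (u := ⟨u, hu⟩)).2 trivial

theorem inner_apply_eq_iff {u v : T.domain} : ⟪T u, (v : E)⟫_𝕜 = ⟪(u : E), T v⟫_𝕜 ↔
    ⟪(Γ.boundaryMap u).2, (Γ.boundaryMap v).2⟫_𝕜 =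
      ⟪(Γ.boundaryMap u).1, (Γ.boundaryMap v).1⟫_𝕜 := by
  rw [← sub_eq_zero, Γ.green, mul_eq_zero, or_iff_right Γ.scale_ne_zero, sub_eq_zero]

theorem adjoint_eq_extension (hSA : S ≤ A) (hAT : A ≤ T) :
    A† = Γ.extension (kreinOrthogonal (Γ.boundarySpace A)) := by
  have hA : Dense (A.domain : Set E) := Γ.dense_domain.mono hSA.1
  have hadj : A† ≤ T := Γ.adjoint_eq ▸ adjoint_anti Γ.dense_domain hSA
  refine le_antisymm (le_of_le_of_domain_le hadj (Γ.extension_le _) fun v hv => ?_)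
    (LinearPMap.IsFormalAdjoint.le_adjoint hA fun u v => ?_)
  · refine (Γ.coe_mem_extension_domain (u := ⟨v, hadj.1 hv⟩)).2 ?_
    rintro _ ⟨u, hu, rfl⟩
    rw [← Γ.inner_apply_eq_iff, ← hAT.2 (x := ⟨u, hu⟩) rfl, ← hadj.2 (x := ⟨v, hv⟩) rfl]
    exact (LinearPMap.adjoint_isFormalAdjoint hA).symm ⟨u, hu⟩ ⟨v, hv⟩
  · have huT := hAT.1 u.2
    have hvT := (Γ.extension_le _).1 v.2
    rw [hAT.2 (y := ⟨u, huT⟩) rfl, (Γ.extension_le _).2 (y := ⟨v, hvT⟩) rfl]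
    exact Γ.inner_apply_eq_iff.2 ((Γ.coe_mem_extension_domain (u := ⟨v, hvT⟩)).1 v.2 _
      (Γ.boundaryMap_mem_boundarySpace u.2))

theorem adjoint_eq_extension_bot : T† = Γ.extension ⊥ := by
  have hT : Γ.boundarySpace T = ⊤ :=
    (congrArg Γ.boundarySpace Γ.extension_top).symm.trans (Γ.boundarySpace_extension ⊤)
  rw [Γ.adjoint_eq_extension Γ.le le_rfl, hT, kreinOrthogonal_top]

theorem closure_le_extension (V : Submodule 𝕜 (K × K)) : S.closure ≤ Γ.extension V := by
  have hS : S ≤ T† :=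
    LinearPMap.IsFormalAdjoint.le_adjoint (Γ.dense_domain.mono Γ.le.1) <| by
      rw [← Γ.adjoint_eq]
      exact LinearPMap.adjoint_isFormalAdjoint Γ.dense_domain
  refine (closure_le_of_le hS (LinearPMap.adjoint_isClosed (Γ.dense_domain.mono Γ.le.1))).trans ?_
  rw [Γ.adjoint_eq_extension_bot]
  exact Γ.extension_mono bot_le

theorem le_extension (V : Submodule 𝕜 (K × K)) : S ≤ Γ.extension V :=
  S.le_closure.trans (Γ.closure_le_extension V)

theorem isSelfAdjoint_extension_iff {V : Submodule 𝕜 (K × K)} :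
    IsSelfAdjoint (Γ.extension V) ↔ kreinOrthogonal V = V := by
  rw [LinearPMap.isSelfAdjoint_def, Γ.adjoint_eq_extension (Γ.le_extension V) (Γ.extension_le V),
    Γ.boundarySpace_extension, Γ.extension_injective.eq_iff]

theorem exists_eq_extension_of_isSelfAdjoint (hA : IsSelfAdjoint A) (hSA : S ≤ A) :
    ∃ V, A = Γ.extension V := by
  rw [LinearPMap.isSelfAdjoint_def] at hA
  have hAT : A ≤ T := by
    rw [← Γ.adjoint_eq, ← hA]
    exact adjoint_anti Γ.dense_domain hSA
  exact ⟨_, hA.symm.trans (Γ.adjoint_eq_extension hSA hAT)⟩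

theorem closure_lt_extension_graph [Nontrivial K] (f : K →ₗ[𝕜] K) :
    S.closure < Γ.extension f.graph :=
  (Γ.closure_le_extension ⊥).trans_lt (Γ.extension_strictMono (bot_lt_graph f))

theorem extension_graph_lt [Nontrivial K] (f : K →ₗ[𝕜] K) : Γ.extension f.graph < T :=
  (Γ.extension_strictMono (graph_lt_top f)).trans_eq Γ.extension_top

variable [CompleteSpace K]

theorem isSelfAdjoint_extension_graph {U : K →L[𝕜] K} (hU : U ∈ unitary (K →L[𝕜] K)) :
    IsSelfAdjoint (Γ.extension (U : K →ₗ[𝕜] K).graph) :=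
  Γ.isSelfAdjoint_extension_iff.2 (kreinOrthogonal_graph_of_mem_unitary hU)

theorem exists_mem_unitary_eq_extension_graph (hA : IsSelfAdjoint A) (hSA : S ≤ A) :
    ∃ U ∈ unitary (K →L[𝕜] K), A = Γ.extension (U : K →ₗ[𝕜] K).graph := by
  obtain ⟨V, rfl⟩ := Γ.exists_eq_extension_of_isSelfAdjoint hA hSA
  obtain ⟨U, hU, rfl⟩ := exists_mem_unitary_graph_eq (Γ.isSelfAdjoint_extension_iff.1 hA)
  exact ⟨U, hU, rfl⟩

end BoundaryTriplet

end BoundaryTriplets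

section AbsoluteContinuity

theorem ac_of_dist_le {X Y : Type*} [PseudoMetricSpace X] [PseudoMetricSpace Y] {f : ℝ → X}
    {g : ℝ → Y} {α β : ℝ} (hg : AbsolutelyContinuousOnInterval g α β)
    (h : ∀ s ∈ uIcc α β, ∀ t ∈ uIcc α β, dist (f s) (f t) ≤ dist (g s) (g t)) :
    AbsolutelyContinuousOnInterval f α β := by
  rw [absolutelyContinuousOnInterval_iff] at hg ⊢
  intro ε hε
  obtain ⟨δ, hδ, hg⟩ := hg ε hε
  refine ⟨δ, hδ, fun E hE hEδ => (Finset.sum_le_sum fun i hi => ?_).trans_lt (hg E hE hEδ)⟩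
  exact h _ (hE.1 i hi).1 _ (hE.1 i hi).2

variable {F : Type*} [NormedAddCommGroup F]

theorem ac_intervalIntegral [NormedSpace ℝ F] [CompleteSpace F] {f : ℝ → F} {α β c : ℝ}
    (hf : IntervalIntegrable f volume α β) (hc : c ∈ uIcc α β) :
    AbsolutelyContinuousOnInterval (fun t => ∫ s in c..t, f s) α β := by
  refine ac_of_dist_le (hf.norm.absolutelyContinuousOnInterval_intervalIntegral hc)
    fun s hs t ht => ?_
  have hsub {u : ℝ} (hu : u ∈ uIcc α β) : IntervalIntegrable f volume c u :=
    hf.mono_set (uIcc_subset_uIcc hc hu)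
  rw [dist_eq_norm, dist_eq_norm,
    intervalIntegral.integral_interval_sub_left (hsub hs) (hsub ht),
    intervalIntegral.integral_interval_sub_left (hsub hs).norm (hsub ht).norm, Real.norm_eq_abs]
  exact intervalIntegral.norm_integral_le_abs_integral_norm

/-- Absolute continuity on every compact interval contained in `s`. -/
def LocallyAC {X : Type*} [PseudoMetricSpace X] (f : ℝ → X) (s : Set ℝ) : Prop :=
  ∀ ⦃α β : ℝ⦄, α ≤ β → Icc α β ⊆ s → AbsolutelyContinuousOnInterval f α β

namespace LocallyAC

variable {f g : ℝ → F} {s : Set ℝ}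

theorem of_contDiffOn [NormedSpace ℝ F] (hf : ContDiffOn ℝ 1 f s) : LocallyAC f s :=
  fun _ _ hαβ hs => (hf.mono (by rwa [uIcc_of_le hαβ])).absolutelyContinuousOnInterval

theorem congr (hf : LocallyAC f s) (h : EqOn f g s) : LocallyAC g s := fun _ _ hαβ hs =>
  ac_of_dist_le (hf hαβ hs) fun u hu v hv => by
    rw [uIcc_of_le hαβ] at hu hv
    rw [h (hs hu), h (hs hv)]

theorem star {f : ℝ → ℂ} (hf : LocallyAC f s) : LocallyAC (fun t => conj (f t)) s :=
  fun _ _ hαβ hs => ac_of_dist_le (hf hαβ hs) fun _ _ _ _ => (dist_star_star _ _).le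

theorem sub (hf : LocallyAC f s) (hg : LocallyAC g s) : LocallyAC (fun t => f t - g t) s :=
  fun _ _ hαβ hs => (hf hαβ hs).sub (hg hαβ hs)

theorem smul {𝔸 : Type*} [SeminormedRing 𝔸] [Module 𝔸 F] [NormSMulClass 𝔸 F] {f : ℝ → 𝔸}
    (hf : LocallyAC f s) (hg : LocallyAC g s) : LocallyAC (fun t => f t • g t) s :=
  fun _ _ hαβ hs => (hf hαβ hs).fun_smul (hg hαβ hs)

theorem continuousOn (hf : LocallyAC f s) (hs : IsOpen s) : ContinuousOn f s := fun t ht => by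
  obtain ⟨ε, hε, hball⟩ := Metric.nhds_basis_closedBall.mem_iff.1 (hs.mem_nhds ht)
  rw [Real.closedBall_eq_Icc] at hball
  have hle : t - ε ≤ t + ε := by linarith
  have hcont := (hf hle hball).continuousOn
  rw [uIcc_of_le hle] at hcont
  exact (hcont.continuousAt (Icc_mem_nhds (by linarith) (by linarith))).continuousWithinAt

variable [NormedSpace ℝ F] [CompleteSpace F]

theorem eq_add_integral {α β c : ℝ} (hg : LocallyAC g (Ioo α β))
    (hf : IntegrableOn f (Ioo α β)) (hd : ∀ᵐ t, t ∈ Ioo α β → HasDerivAt g (f t) t)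
    (hc : c ∈ Ioo α β) {t : ℝ} (ht : t ∈ Ioo α β) : g t = g c + ∫ s in c..t, f s := by
  wlog hct : c ≤ t generalizing c t
  · rw [this ht hc (le_of_not_ge hct), intervalIntegral.integral_symm t c]
    exact (add_neg_cancel_right _ _).symm
  have hs : Icc c t ⊆ Ioo α β := Icc_subset_Ioo hc.1 ht.2
  have hi : IntervalIntegrable f volume c t :=
    (intervalIntegrable_iff_integrableOn_Icc_of_le hct).2 (hf.mono_set hs)
  obtain ⟨C, hC⟩ := ((hg hct hs).sub (ac_intervalIntegral hi left_mem_uIcc)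
    ).const_of_ae_hasDerivAt_zero (by
      filter_upwards [hd, hi.ae_hasDerivAt_integral] with r hr hr' hrs
      simpa using (hr (hs (uIcc_of_le hct ▸ hrs))).sub (hr' hrs c left_mem_uIcc))
  have hCc : g c = C := by simpa using hC c left_mem_uIcc
  have hCt : g t - ∫ s in c..t, f s = C := hC t right_mem_uIcc
  rw [hCc, ← hCt, sub_add_cancel]

theorem exists_tendsto_integral_eq {α β : ℝ} (hαβ : α < β) (hg : LocallyAC g (Ioo α β))
    (hf : IntegrableOn f (Ioo α β)) (hd : ∀ᵐ t, t ∈ Ioo α β → HasDerivAt g (f t) t) :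
    ∃ l r, Tendsto g (𝓝[>] α) (𝓝 l) ∧ Tendsto g (𝓝[<] β) (𝓝 r) ∧
      ∫ t in Ioo α β, f t = r - l := by
  obtain ⟨c, hc⟩ := exists_between hαβ
  have hi : IntervalIntegrable f volume α β :=
    (intervalIntegrable_iff_integrableOn_Ioo_of_le hαβ.le).2 hf
  have hcI : c ∈ uIcc α β := uIcc_of_le hαβ.le ▸ ⟨hc.1.le, hc.2.le⟩
  have hG : ContinuousOn (fun t => g c + ∫ s in c..t, f s) (Icc α β) := by
    rw [← uIcc_of_le hαβ.le]
    exact continuousOn_const.add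
      (intervalIntegral.continuousOn_primitive_interval' hi hcI)
  have hgG : EqOn (fun t => g c + ∫ s in c..t, f s) g (Ioo α β) := fun t ht =>
    (hg.eq_add_integral hf hd hc ht).symm
  have key {x : ℝ} {S : Set ℝ} (hx : x ∈ Icc α β) (hS : 𝓝[S] x = 𝓝[Ioo α β] x) :
      Tendsto g (𝓝[S] x) (𝓝 (g c + ∫ s in c..x, f s)) := by
    rw [hS]
    exact ((hG x hx).mono Ioo_subset_Icc_self).congr' (hgG.eventuallyEq_nhdsWithin)
  refine ⟨_, _, key ⟨le_rfl, hαβ.le⟩ (nhdsWithin_Ioo_eq_nhdsGT hαβ).symm,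
    key ⟨hαβ.le, le_rfl⟩ (nhdsWithin_Ioo_eq_nhdsLT hαβ).symm, ?_⟩
  have hsub {x : ℝ} (hx : x ∈ uIcc α β) : IntervalIntegrable f volume c x :=
    hi.mono_set (uIcc_subset_uIcc hcI hx)
  rw [add_sub_add_left_eq_sub, intervalIntegral.integral_interval_sub_left
    (hsub right_mem_uIcc) (hsub left_mem_uIcc), intervalIntegral.integral_of_le hαβ.le,
    integral_Ioc_eq_integral_Ioo]

end LocallyAC

end AbsoluteContinuity

section TestFunctions

variable {X : Type*} [TopologicalSpace X]

/-- The space of continuous `𝕜`-valued functions whose support is a compact subset of `s`. -/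
def testFunctions (𝕜 : Type*) [RCLike 𝕜] (s : Set X) : Submodule 𝕜 (X → 𝕜) where
  carrier := {φ | Continuous φ ∧ HasCompactSupport φ ∧ tsupport φ ⊆ s}
  zero_mem' := ⟨continuous_zero, .zero, by simp [tsupport]⟩
  add_mem' hφ hψ := ⟨hφ.1.add hψ.1, hφ.2.1.add hψ.2.1,
    (tsupport_add _ _).trans (union_subset hφ.2.2 hψ.2.2)⟩
  smul_mem' c _ hφ := ⟨hφ.1.const_smul c, hφ.2.1.smul_left (f := fun _ => c),
    (tsupport_smul_subset_right (fun _ => c) _).trans hφ.2.2⟩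

variable {𝕜 : Type*} [RCLike 𝕜] {s : Set X} [MeasurableSpace X] [BorelSpace X]
  [T2Space X] {μ : Measure X} {g : X → 𝕜}

theorem integrable_mul_of_mem_testFunctions (hg : LocallyIntegrableOn g s μ) {φ : X → 𝕜}
    (hφ : φ ∈ testFunctions 𝕜 s) : Integrable (fun t => φ t * g t) μ :=
  (integrableOn_iff_integrable_of_support_subset
    ((Function.support_mul_subset_left φ g).trans (subset_tsupport φ))).1
    ((hg.integrableOn_compact_subset hφ.2.2 hφ.2.1).continuousOn_mul hφ.1.continuousOn hφ.2.1)

/-- The functional `φ ↦ ∫ φ g` on the test functions on `s`. -/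
def testIntegral (hg : LocallyIntegrableOn g s μ) : testFunctions 𝕜 s →ₗ[𝕜] 𝕜 where
  toFun φ := ∫ t, (φ : X → 𝕜) t * g t ∂μ
  map_add' φ ψ := by
    rw [← integral_add (integrable_mul_of_mem_testFunctions hg φ.2)
      (integrable_mul_of_mem_testFunctions hg ψ.2)]
    exact integral_congr_ae (.of_forall fun t => add_mul _ _ _)
  map_smul' c φ := by
    rw [RingHom.id_apply, smul_eq_mul, ← integral_const_mul]
    exact integral_congr_ae (.of_forall fun t => mul_assoc _ _ _)

end TestFunctions

section Annihilator

variable {E : Type*} [NormedAddCommGroup E] [NormedSpace ℝ E] [FiniteDimensional ℝ E]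
  [MeasurableSpace E] [BorelSpace E] {μ : Measure E} {𝕜 : Type*} [RCLike 𝕜] {s : Set E}
  {g : E → 𝕜}

theorem ae_eq_zero_of_testIntegral_eq_zero (hs : IsOpen s) (hg : LocallyIntegrableOn g s μ)
    (h : ∀ φ ∈ testFunctions 𝕜 s, ∫ t, φ t * g t ∂μ = 0) : ∀ᵐ t ∂μ, t ∈ s → g t = 0 := by
  refine hs.ae_eq_zero_of_integral_contDiff_smul_eq_zero hg fun φ hφ hφc hφs => ?_
  have hmem : (fun t => (φ t : 𝕜)) ∈ testFunctions 𝕜 s :=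
    ⟨RCLike.continuous_ofReal.comp hφ.continuous, hφc.comp_left RCLike.ofReal_zero,
      (closure_mono (Function.support_comp_subset RCLike.ofReal_zero φ)).trans hφs⟩
  simpa only [RCLike.real_smul_eq_coe_mul] using h _ hmem

theorem exists_ae_eq_sum_of_testIntegral_eq_zero {ι : Type*} [Fintype ι] (hs : IsOpen s)
    (hg : LocallyIntegrableOn g s μ) {w : ι → E → 𝕜}
    (hw : ∀ i, LocallyIntegrableOn (w i) s μ)
    (h : ∀ φ ∈ testFunctions 𝕜 s, (∀ i, ∫ t, φ t * w i t ∂μ = 0) → ∫ t, φ t * g t ∂μ = 0) :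
    ∃ c : ι → 𝕜, ∀ᵐ t ∂μ, t ∈ s → g t = ∑ i, c i * w i t := by
  -- A linear functional vanishing where finitely many others do is a combination of them.
  obtain ⟨c, hc⟩ := (Submodule.mem_span_range_iff_exists_fun 𝕜).1 <|
    mem_span_of_iInf_ker_le_ker (L := fun i => testIntegral (hw i)) (K := testIntegral hg)
      fun φ hφ => h φ φ.2 fun i => (Submodule.mem_iInf _).1 hφ i
  have hsum : LocallyIntegrableOn (∑ i, c i • w i) s μ :=
    Finset.sum_induction _ (LocallyIntegrableOn · s μ) (fun _ _ => .add)
      locallyIntegrableOn_zero fun i _ => (hw i).smul (c i)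
  have hcg (φ : E → 𝕜) (hφ : φ ∈ testFunctions 𝕜 s) :
      ∫ t, φ t * (g - ∑ i, c i • w i) t ∂μ = 0 := by
    have hcφ : ∑ i, c i * ∫ t, φ t * w i t ∂μ = ∫ t, φ t * g t ∂μ := by
      simpa [testIntegral] using LinearMap.congr_fun hc ⟨φ, hφ⟩
    have hi (i) : Integrable (fun t => c i * (φ t * w i t)) μ :=
      (integrable_mul_of_mem_testFunctions (hw i) hφ).const_mul _
    calc ∫ t, φ t * (g - ∑ i, c i • w i) t ∂μ
        = ∫ t, (φ t * g t - ∑ i, c i * (φ t * w i t)) ∂μ := by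
          simp only [Pi.sub_apply, Finset.sum_apply, Pi.smul_apply, smul_eq_mul, mul_sub,
            Finset.mul_sum, mul_left_comm]
      _ = 0 := by
          rw [integral_sub (integrable_mul_of_mem_testFunctions hg hφ)
            (integrable_finsetSum _ fun i _ => hi i), integral_finsetSum _ fun i _ => hi i, ← hcφ]
          simp only [integral_const_mul, sub_self]
  refine ⟨c, ?_⟩
  filter_upwards [ae_eq_zero_of_testIntegral_eq_zero hs (hg.sub hsum) hcg] with t ht hts
  simpa [sub_eq_zero] using ht hts

end Annihilator

section Logarithm

theorem log_sq_le {s : ℝ} (hs : 0 < s) :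
    Real.log s ^ 2 ≤ 16 * (s ^ (1 / 2 : ℝ) + s ^ (-1 / 2 : ℝ)) := by
  have key {r : ℝ} (hr : 0 < r) (hr0 : 0 ≤ Real.log r) :
      Real.log r ^ 2 ≤ 16 * r ^ (1 / 2 : ℝ) := by
    have h := pow_le_pow_left₀ hr0 (Real.log_le_rpow_div hr.le (ε := 1 / 4) (by norm_num)) 2
    rw [div_pow, ← Real.rpow_mul_natCast hr.le] at h
    norm_num at h ⊢
    linarith
  rcases le_total 1 s with h | h
  · linarith [key hs (Real.log_nonneg h), Real.rpow_nonneg hs.le (-1 / 2)]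
  · have hinv := key (inv_pos.2 hs) (by
      rw [Real.log_inv]; exact neg_nonneg.2 (Real.log_nonpos hs.le h))
    rw [Real.log_inv, neg_sq, Real.inv_rpow hs.le, ← Real.rpow_neg hs.le, ← neg_div] at hinv
    linarith [Real.rpow_nonneg hs.le (1 / 2)]

theorem intervalIntegrable_log_sq (c d : ℝ) :
    IntervalIntegrable (fun s => Real.log s ^ 2) volume c d := by
  refine intervalIntegrable_of_even (fun s => by rw [Real.log_neg_eq_log]) fun s hs => ?_
  have hpow {r : ℝ} (hr : -1 < r) : IntervalIntegrable (fun s : ℝ => s ^ r) volume 0 s :=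
    intervalIntegral.intervalIntegrable_rpow' hr
  refine (((hpow (r := 1 / 2) (by norm_num)).add
    (hpow (r := -1 / 2) (by norm_num))).const_mul 16).mono_fun'
    (Real.measurable_log.pow_const 2).aestronglyMeasurable ?_
  filter_upwards [ae_restrict_mem measurableSet_uIoc] with r hr
  rw [uIoc_of_le hs.le] at hr
  rw [Real.norm_of_nonneg (sq_nonneg _)]
  exact log_sq_le hr.1

theorem tendsto_mul_log_sq_nhdsNE_zero :
    Tendsto (fun s : ℝ => s * Real.log s ^ 2) (𝓝[≠] 0) (𝓝 0) := by
  have hlim : Tendsto (fun s : ℝ => 16 * (|s| ^ (3 / 2 : ℝ) + |s| ^ (1 / 2 : ℝ))) (𝓝[≠] 0)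
      (𝓝 0) := by
    have h : Continuous fun s : ℝ => 16 * (|s| ^ (3 / 2 : ℝ) + |s| ^ (1 / 2 : ℝ)) :=
      continuous_const.mul ((continuous_abs.rpow_const fun _ => .inr (by norm_num)).add
        (continuous_abs.rpow_const fun _ => .inr (by norm_num)))
    simpa using (h.tendsto 0).mono_left nhdsWithin_le_nhds
  refine squeeze_zero_norm' ?_ hlim
  filter_upwards [self_mem_nhdsWithin] with s hs
  have hs' : 0 < |s| := abs_pos.2 hs
  calc ‖s * Real.log s ^ 2‖ = |s| * Real.log |s| ^ 2 := by
        rw [norm_mul, Real.norm_eq_abs, Real.log_abs, Real.norm_of_nonneg (sq_nonneg _)]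
    _ ≤ |s| * (16 * (|s| ^ (1 / 2 : ℝ) + |s| ^ (-1 / 2 : ℝ))) :=
        mul_le_mul_of_nonneg_left (log_sq_le hs') hs'.le
    _ = 16 * (|s| ^ (3 / 2 : ℝ) + |s| ^ (1 / 2 : ℝ)) := by
        rw [show (3 / 2 : ℝ) = 1 + 1 / 2 by norm_num, Real.rpow_one_add' hs'.le (by norm_num),
          show (1 / 2 : ℝ) = 1 + -1 / 2 by norm_num, Real.rpow_one_add' hs'.le (by norm_num)]
        norm_num
        ring

end Logarithm

section Coefficient

/-- The leading coefficient `1 - t² / a²` of the prolate operator. -/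
abbrev weight (a t : ℝ) : ℝ := 1 - t ^ 2 / a ^ 2

/-- The odd solution `y` of `((1 - t² / a²) y')' = 0` on `(-a, a)` with `(1 - t² / a²) y' = 1`.
As `Real.log` is even, the formula also describes `(a / 2) log ((a + t) / (a - t))`, and it is
unchanged when `a` is replaced by `-a`, so that the two endpoints play the same role. -/
def logSolution (a t : ℝ) : ℝ := a / 2 * (Real.log (t + a) - Real.log (t - a))

variable {a t : ℝ}

theorem weight_neg_left (a t : ℝ) : weight (-a) t = weight a t := by
  rw [weight, weight, neg_sq]

theorem logSolution_neg_left (a t : ℝ) : logSolution (-a) t = logSolution a t := by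
  rw [logSolution, logSolution, ← sub_eq_add_neg, sub_neg_eq_add]
  ring

theorem weight_eq (ha : a ≠ 0) (t : ℝ) : weight a t = -((t - a) * (t + a) / a ^ 2) := by
  rw [weight]
  field_simp
  ring

theorem contDiff_weight (a : ℝ) : ContDiff ℝ ∞ (weight a) := by
  unfold weight
  fun_prop

theorem weight_pos (ht : t ∈ Ioo (-a) a) : 0 < weight a t := by
  have ha : 0 < a := by linarith [ht.1, ht.2]
  rw [weight, sub_pos, div_lt_one (by positivity)]
  exact sq_lt_sq' ht.1 ht.2

theorem hasDerivAt_logSolution (ht : t ∈ Ioo (-a) a) :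
    HasDerivAt (logSolution a) (weight a t)⁻¹ t := by
  have hadd : t + a ≠ 0 := by linarith [ht.1]
  have hsub : t - a ≠ 0 := by linarith [ht.2]
  have ha : a ≠ 0 := by linarith [ht.1, ht.2]
  refine (((((hasDerivAt_id t).add_const a).log hadd).sub
    (((hasDerivAt_id t).sub_const a).log hsub)).const_mul (a / 2)).congr_deriv ?_
  rw [weight_eq ha, id]
  field_simp
  ring

theorem memLp_logSolution (a : ℝ) : MemLp (logSolution a) 2 (mu a) := by
  have key (c : ℝ) : MemLp (fun t => Real.log (t - c)) 2 (mu a) := by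
    refine (memLp_two_iff_integrable_sq
      (Real.measurable_log.comp (measurable_id.sub_const c)).aestronglyMeasurable).2 ?_
    rcases le_total (-a) a with ha | ha
    · exact (intervalIntegrable_iff_integrableOn_Ioo_of_le ha).1 <| by
        simpa using (intervalIntegrable_log_sq (-a - c) (a - c)).comp_sub_right c
    · rw [mu, Ioo_eq_empty_of_le ha, Measure.restrict_empty]
      exact integrable_zero_measure
  have hadd := key (-a)
  simp only [sub_neg_eq_add] at hadd
  exact (hadd.sub (key a)).const_mul (a / 2)

end Coefficient

section Endpoint

variable {e : ℝ}

theorem tendsto_sub_nhdsNE (e : ℝ) : Tendsto (fun t : ℝ => t - e) (𝓝[≠] e) (𝓝[≠] 0) :=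
  tendsto_nhdsWithin_iff.2 ⟨by
    simpa using ((continuous_sub_right e).tendsto e).mono_left nhdsWithin_le_nhds,
    eventually_nhdsWithin_of_forall fun _ => sub_ne_zero.2⟩

theorem tendsto_sub_mul_log_sub (e : ℝ) :
    Tendsto (fun t => (t - e) * Real.log (t - e)) (𝓝[≠] e) (𝓝 0) := by
  have h := Real.continuous_mul_log.tendsto 0
  rw [zero_mul] at h
  exact (h.mono_left nhdsWithin_le_nhds).comp (tendsto_sub_nhdsNE e)

theorem tendsto_log_add_self (he : e ≠ 0) :
    Tendsto (fun t => Real.log (t + e)) (𝓝[≠] e) (𝓝 (Real.log (2 * e))) := by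
  rw [two_mul]
  exact (((continuous_add_const e).tendsto e).log (by simpa using he)).mono_left
    nhdsWithin_le_nhds

theorem tendsto_weight_mul_logSolution_sq (he : e ≠ 0) :
    Tendsto (fun t => weight e t * logSolution e t ^ 2) (𝓝[≠] e) (𝓝 0) := by
  have hsub := (tendsto_sub_nhdsNE e).mono_right nhdsWithin_le_nhds
  have hlog := tendsto_log_add_self he
  have hadd : Tendsto (fun t => t + e) (𝓝[≠] e) (𝓝 (e + e)) :=
    ((continuous_add_const e).tendsto e).mono_left nhdsWithin_le_nhds
  have hquad := ((hsub.mul (hlog.pow 2)).sub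
    ((hlog.mul (tendsto_sub_mul_log_sub e)).const_mul 2)).add
    (tendsto_mul_log_sq_nhdsNE_zero.comp (tendsto_sub_nhdsNE e))
  have hlim := (hadd.mul hquad).const_mul (-(1 / 4))
  simp only [zero_mul, mul_zero, sub_zero, add_zero] at hlim
  refine hlim.congr fun t => ?_
  simp only [Function.comp_apply, weight_eq he, logSolution]
  field_simp
  ring

theorem tendsto_weight (he : e ≠ 0) : Tendsto (weight e) (𝓝[≠] e) (𝓝 0) := by
  have h := ((contDiff_weight e).continuous.tendsto e).mono_left
    (nhdsWithin_le_nhds (s := {e}ᶜ))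
  rwa [weight, div_self (pow_ne_zero 2 he), sub_self] at h

theorem tendsto_weight_mul_logSolution (he : e ≠ 0) :
    Tendsto (fun t => weight e t * logSolution e t) (𝓝[≠] e) (𝓝 0) := by
  have hsq := (tendsto_weight he).mul (tendsto_weight_mul_logSolution_sq he)
  rw [zero_mul] at hsq
  have hsqrt := (Real.continuous_sqrt.tendsto 0).comp hsq
  rw [Real.sqrt_zero] at hsqrt
  refine squeeze_zero_norm (fun t => ?_) hsqrt
  rw [Function.comp_apply, Real.norm_eq_abs, ← Real.sqrt_sq_eq_abs]
  exact (congrArg Real.sqrt (by ring)).le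

end Endpoint

section Flux

/-- The quasi-derivative `(1 - t² / a²) x'`. -/
def flux (a : ℝ) (x : ℝ → ℂ) (t : ℝ) : ℂ := (weight a t : ℂ) * deriv x t

variable {a : ℝ} {x F : ℝ → ℂ} {t : ℝ}

theorem flux_neg_left (a : ℝ) (x : ℝ → ℂ) : flux (-a) x = flux a x := by
  ext t
  rw [flux, flux, weight_neg_left]

namespace ClassA

theorem locallyAC_deriv (hx : ClassA a x) : LocallyAC (deriv x) (Ioo (-a) a) := fun _ _ hαβ hs =>
  hx.ac _ _ (hs (left_mem_Icc.2 hαβ)).1 hαβ (hs (right_mem_Icc.2 hαβ)).2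

theorem locallyAC (hx : ClassA a x) : LocallyAC x (Ioo (-a) a) :=
  .of_contDiffOn <| (contDiffOn_succ_iff_deriv_of_isOpen (n := 0) isOpen_Ioo).2
    ⟨fun t ht => (hx.diff t ht).differentiableWithinAt, by simp,
      contDiffOn_zero.2 (hx.locallyAC_deriv.continuousOn isOpen_Ioo)⟩

theorem continuousOn (hx : ClassA a x) : ContinuousOn x (Ioo (-a) a) :=
  hx.locallyAC.continuousOn isOpen_Ioo

theorem locallyAC_flux (hx : ClassA a x) : LocallyAC (flux a x) (Ioo (-a) a) :=
  (LocallyAC.of_contDiffOn ((Complex.ofRealCLM.contDiff.comp (contDiff_weight a)).of_le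
    (by simp)).contDiffOn).smul hx.locallyAC_deriv

theorem ae_hasDerivAt_flux (hx : ClassA a x) :
    ∀ᵐ t, t ∈ Ioo (-a) a →
      HasDerivAt (flux a x) (((t ^ 2 : ℝ) : ℂ) * x t - formalL a x t) t := by
  filter_upwards [(ae_restrict_iff' measurableSet_Ioo).1 hx.ae_differentiableAt] with t ht htI
  refine (differentiableAt_flux a (ht htI)).hasDerivAt.congr_deriv ?_
  rw [formalL]
  ring

end ClassA

theorem flux_eq_of_hasDerivAt (ht : t ∈ Ioo (-a) a)
    (hx : HasDerivAt x (F t / (weight a t : ℂ)) t) : flux a x t = F t := by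
  rw [flux, hx.deriv]
  exact mul_div_cancel₀ _ (Complex.ofReal_ne_zero.2 (weight_pos ht).ne')

theorem classA_of_hasDerivAt (hF : LocallyAC F (Ioo (-a) a))
    (hx : ∀ t ∈ Ioo (-a) a, HasDerivAt x (F t / (weight a t : ℂ)) t) : ClassA a x := by
  have hinv : ContDiffOn ℝ 1 (fun t => (((weight a t)⁻¹ : ℝ) : ℂ)) (Ioo (-a) a) :=
    Complex.ofRealCLM.contDiff.comp_contDiffOn <|
      ((contDiff_weight a).of_le (by simp)).contDiffOn.inv fun t ht => (weight_pos ht).ne'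
  have hderiv : LocallyAC (deriv x) (Ioo (-a) a) :=
    ((LocallyAC.of_contDiffOn hinv).smul hF).congr fun t ht => by
      simp only [(hx t ht).deriv, smul_eq_mul, Complex.ofReal_inv, div_eq_inv_mul]
  exact ⟨fun t ht => (hx t ht).differentiableAt, fun α β hα hαβ hβ =>
    hderiv hαβ (Icc_subset_Ioo hα hβ)⟩

theorem formalL_eq_of_hasDerivAt {f : ℂ} (ht : t ∈ Ioo (-a) a)
    (hx : ∀ t ∈ Ioo (-a) a, HasDerivAt x (F t / (weight a t : ℂ)) t) (hF : HasDerivAt F f t) :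
    formalL a x t = -f + ((t ^ 2 : ℝ) : ℂ) * x t := by
  have hflux : flux a x =ᶠ[𝓝 t] F := by
    filter_upwards [isOpen_Ioo.mem_nhds ht] with s hs using flux_eq_of_hasDerivAt hs (hx s hs)
  rw [← hF.deriv, ← hflux.deriv_eq]
  rfl

end Flux

section Wronskian

/-- The sesquilinear Wronskian `conj x · (1 - t² / a²) y' - conj ((1 - t² / a²) x') · y`. -/
def wronskian (a : ℝ) (x y : ℝ → ℂ) (t : ℝ) : ℂ :=
  conj (x t) * flux a y t - conj (flux a x t) * y t

/-- The functions whose classes in `L²` form the domain of the maximal operator. -/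
structure InMaxDomain (a : ℝ) (x : ℝ → ℂ) : Prop where
  classA : ClassA a x
  memLp : MemLp x 2 (mu a)
  memLp_formalL : MemLp (formalL a x) 2 (mu a)

variable {a : ℝ} {x y : ℝ → ℂ}

theorem wronskian_neg_left (a : ℝ) (x y : ℝ → ℂ) : wronskian (-a) x y = wronskian a x y := by
  ext t
  rw [wronskian, wronskian, flux_neg_left, flux_neg_left]

namespace ClassA

theorem locallyAC_wronskian (hx : ClassA a x) (hy : ClassA a y) :
    LocallyAC (wronskian a x y) (Ioo (-a) a) :=
  (hx.locallyAC.star.smul hy.locallyAC_flux).sub (hx.locallyAC_flux.star.smul hy.locallyAC)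

theorem ae_hasDerivAt_wronskian (hx : ClassA a x) (hy : ClassA a y) :
    ∀ᵐ t, t ∈ Ioo (-a) a → HasDerivAt (wronskian a x y)
      (conj (formalL a x t) * y t - conj (x t) * formalL a y t) t := by
  filter_upwards [hx.ae_hasDerivAt_flux, hy.ae_hasDerivAt_flux] with t hxt hyt ht
  refine (((hx.diff t ht).hasDerivAt.star.mul (hyt ht)).sub
    ((hxt ht).star.mul (hy.diff t ht).hasDerivAt)).congr_deriv ?_
  simp only [flux, star_mul', star_sub, RCLike.star_def, Complex.conj_ofReal]
  ring

end ClassA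

theorem InMaxDomain.exists_tendsto_wronskian (ha : 0 < a) (hx : InMaxDomain a x)
    (hy : InMaxDomain a y) :
    ∃ l r, Tendsto (wronskian a x y) (𝓝[Ioo (-a) a] (-a)) (𝓝 l) ∧
      Tendsto (wronskian a x y) (𝓝[Ioo (-a) a] a) (𝓝 r) ∧
      ∫ t, (conj (formalL a x t) * y t - conj (x t) * formalL a y t) ∂mu a = r - l := by
  have hlt : -a < a := neg_lt_self ha
  rw [nhdsWithin_Ioo_eq_nhdsGT hlt, nhdsWithin_Ioo_eq_nhdsLT hlt]
  exact (hx.classA.locallyAC_wronskian hy.classA).exists_tendsto_integral_eq hlt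
    ((hx.memLp_formalL.star.integrable_mul hy.memLp).sub
      (hx.memLp.star.integrable_mul hy.memLp_formalL))
    (hx.classA.ae_hasDerivAt_wronskian hy.classA)

end Wronskian

section EndpointValues

/-- `b` and `c` are the generalized boundary values of `x` at the endpoint `e` along the filter
`l`. As `Real.log` is even, `Real.log (t - e)` is the logarithm of the distance to `e`, whichever
of the two endpoints `e` is. -/
structure HasEndpointValues (e : ℝ) (l : Filter ℝ) (x : ℝ → ℂ) (b c : ℂ) : Prop where
  b_lim : Tendsto (fun t => ((t - e : ℝ) : ℂ) * deriv x t) l (𝓝 b)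
  c_lim : Tendsto (fun t => (((t - e) * Real.log (t - e) : ℝ) : ℂ) * deriv x t - x t) l (𝓝 c)

theorem hasBoundaryValues_iff {a : ℝ} {x : ℝ → ℂ} {bm cm bp cp : ℂ} :
    HasBoundaryValues a x bm cm bp cp ↔
      HasEndpointValues (-a) (𝓝[Ioo (-a) a] (-a)) x bm cm ∧
        HasEndpointValues a (𝓝[Ioo (-a) a] a) x bp cp := by
  have hlog (t : ℝ) : Real.log (a - t) = Real.log (t - a) := by
    rw [← Real.log_neg_eq_log, neg_sub]
  have hadd (t : ℝ) : a + t = t + a := add_comm a t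
  constructor
  · rintro ⟨hbm, hcm, hbp, hcp⟩
    simp only [hlog, hadd] at hcm hcp
    exact ⟨⟨by simpa only [sub_neg_eq_add], by simpa only [sub_neg_eq_add]⟩, hbp, hcp⟩
  · rintro ⟨⟨hbm, hcm⟩, hbp, hcp⟩
    simp only [sub_neg_eq_add] at hbm hcm
    exact ⟨hbm, by simpa only [hadd], hbp, by simpa only [hlog]⟩

variable {e : ℝ} {l : Filter ℝ} {x y : ℝ → ℂ}

namespace HasEndpointValues

theorem unique [l.NeBot] {b c b' c' : ℂ} (h : HasEndpointValues e l x b c)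
    (h' : HasEndpointValues e l x b' c') : b = b' ∧ c = c' :=
  ⟨tendsto_nhds_unique h.b_lim h'.b_lim, tendsto_nhds_unique h.c_lim h'.c_lim⟩

theorem of_tendsto_flux (he : e ≠ 0) (hl : l ≤ 𝓝[≠] e) {β γ : ℂ}
    (hβ : Tendsto (flux e x) l (𝓝 β))
    (hγ : Tendsto (fun t => (logSolution e t : ℂ) * flux e x t - x t) l (𝓝 γ)) :
    HasEndpointValues e l x (-(e / 2 * β)) (γ - e / 2 * Real.log (2 * e) * β) := by
  have hadd : Tendsto (fun t => t + e) l (𝓝 (e + e)) :=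
    ((continuous_add_const e).tendsto e).mono_left (hl.trans nhdsWithin_le_nhds)
  have he2 : e + e ≠ 0 := by simpa using he
  have he' : (e : ℂ) ≠ 0 := Complex.ofReal_ne_zero.2 he
  constructor
  · have hquot := ((tendsto_const_nhds (x := e ^ 2)).div hadd he2).neg.ofReal.mul hβ
    convert hquot.congr' ?_ using 2
    · push_cast
      field_simp
      ring
    · filter_upwards [hadd.eventually_ne he2] with t ht
      have ht' : (t : ℂ) + e ≠ 0 := by exact_mod_cast ht
      rw [Pi.div_apply, flux, weight_eq he]
      push_cast
      field_simp
  · have hcoeff := ((((tendsto_sub_mul_log_sub e).mono_left hl).const_mul (e / 2)).div hadd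
      he2).sub (((tendsto_log_add_self he).mono_left hl).const_mul (e / 2))
    convert (hγ.add (hcoeff.ofReal.mul hβ)).congr' ?_ using 2
    · push_cast
      ring
    · filter_upwards [hadd.eventually_ne he2] with t ht
      have ht' : (t : ℂ) + e ≠ 0 := by exact_mod_cast ht
      rw [Pi.div_apply, flux, weight_eq he, logSolution]
      push_cast
      field_simp
      ring

theorem tendsto_wronskian {b c b' c' : ℂ} (he : e ≠ 0) (hl : l ≤ 𝓝[≠] e)
    (hx : HasEndpointValues e l x b c) (hy : HasEndpointValues e l y b' c') :
    Tendsto (wronskian e x y) l (𝓝 (-(2 / e) * (conj b * c' - conj c * b'))) := by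
  have hadd : Tendsto (fun t => t + e) l (𝓝 (e + e)) :=
    ((continuous_add_const e).tendsto e).mono_left (hl.trans nhdsWithin_le_nhds)
  have hlim := (hadd.div_const (e ^ 2)).neg.ofReal.mul
    ((hx.b_lim.star.mul hy.c_lim).sub (hx.c_lim.star.mul hy.b_lim))
  convert hlim.congr fun t => ?_ using 2
  · push_cast
    simp only [RCLike.star_def]
    field_simp
    ring
  · simp only [wronskian, flux, weight_eq he, RCLike.star_def, map_sub, map_mul,
      Complex.conj_ofReal]
    push_cast
    field_simp
    ring

end HasEndpointValues

end EndpointValues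

section AffineLog

variable {a : ℝ}

theorem memLp_top_of_continuous (a : ℝ) {g : ℝ → ℂ} (hg : Continuous g) : MemLp g ⊤ (mu a) := by
  obtain ⟨C, hC⟩ := isCompact_Icc.exists_bound_of_continuousOn (s := Icc (-a) a) hg.continuousOn
  exact memLp_top_of_bound hg.aestronglyMeasurable C <|
    ae_restrict_of_forall_mem measurableSet_Ioo fun t ht => hC t (Ioo_subset_Icc_self ht)

theorem memLp_continuous_mul {g f : ℝ → ℂ} (hg : Continuous g) (hf : MemLp f 2 (mu a)) :
    MemLp (fun t => g t * f t) 2 (mu a) :=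
  hf.mul (memLp_top_of_continuous a hg)

theorem InMaxDomain.of_hasDerivAt {x F f : ℝ → ℂ} (hF : LocallyAC F (Ioo (-a) a))
    (hx : ∀ t ∈ Ioo (-a) a, HasDerivAt x (F t / (weight a t : ℂ)) t)
    (hFf : ∀ᵐ t, t ∈ Ioo (-a) a → HasDerivAt F (f t) t) (hxLp : MemLp x 2 (mu a))
    (hfLp : MemLp f 2 (mu a)) : InMaxDomain a x := by
  refine ⟨classA_of_hasDerivAt hF hx, hxLp, (hfLp.neg.add (memLp_continuous_mul
    (g := fun t => ((t ^ 2 : ℝ) : ℂ)) (by fun_prop) hxLp)).ae_eq ?_⟩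
  filter_upwards [(ae_restrict_iff' measurableSet_Ioo).2 hFf,
    ae_restrict_mem measurableSet_Ioo] with t hFft ht
  exact (formalL_eq_of_hasDerivAt ht hx hFft).symm

/-- Affine functions plus affine multiples of `logSolution a`. Near an endpoint they realize
every pair of boundary values. -/
def affineLog (a : ℝ) (A₀ A₁ B₀ B₁ : ℂ) (t : ℝ) : ℂ :=
  A₀ + A₁ * t + (B₀ + B₁ * t) * logSolution a t

/-- The quasi-derivative of `affineLog a A₀ A₁ B₀ B₁`. -/
def affineLogFlux (a : ℝ) (A₁ B₀ B₁ : ℂ) (t : ℝ) : ℂ :=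
  weight a t * (A₁ + B₁ * logSolution a t) + (B₀ + B₁ * t)

variable (A₀ A₁ B₀ B₁ : ℂ)

theorem hasDerivAt_affineLog {t : ℝ} (ht : t ∈ Ioo (-a) a) :
    HasDerivAt (affineLog a A₀ A₁ B₀ B₁) (affineLogFlux a A₁ B₀ B₁ t / (weight a t : ℂ)) t := by
  have hp : (weight a t : ℂ) ≠ 0 := Complex.ofReal_ne_zero.2 (weight_pos ht).ne'
  have hid := (hasDerivAt_id t).ofReal_comp
  refine (((hid.const_mul A₁).const_add A₀).add (((hid.const_mul B₁).const_add B₀).mul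
    (hasDerivAt_logSolution ht).ofReal_comp)).congr_deriv ?_
  simp only [affineLogFlux, id, Complex.ofReal_inv, Complex.ofReal_one]
  field_simp
  ring

theorem hasDerivAt_affineLogFlux {t : ℝ} (ht : t ∈ Ioo (-a) a) :
    HasDerivAt (affineLogFlux a A₁ B₀ B₁)
      (2 * B₁ - 2 * t / a ^ 2 * (A₁ + B₁ * logSolution a t)) t := by
  have hp : (weight a t : ℂ) ≠ 0 := Complex.ofReal_ne_zero.2 (weight_pos ht).ne'
  have hid := (hasDerivAt_id t).ofReal_comp
  have hweight : HasDerivAt (weight a) (-(2 * t / a ^ 2)) t := by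
    simpa [weight] using ((hasDerivAt_pow 2 t).div_const (a ^ 2)).const_sub 1
  refine ((hweight.ofReal_comp.mul (((hasDerivAt_logSolution ht).ofReal_comp.const_mul B₁).const_add
    A₁)).add ((hid.const_mul B₁).const_add B₀)).congr_deriv ?_
  simp only [Complex.ofReal_inv, Complex.ofReal_one]
  field_simp
  push_cast
  ring

theorem locallyAC_affineLogFlux : LocallyAC (affineLogFlux a A₁ B₀ B₁) (Ioo (-a) a) := by
  have hlog : ContDiffOn ℝ 1 (logSolution a) (Ioo (-a) a) :=
    contDiffOn_const.mul (((contDiff_id.add contDiff_const).contDiffOn.log fun t ht => by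
      simpa using (neg_lt_iff_pos_add.1 ht.1).ne').sub
      ((contDiff_id.sub contDiff_const).contDiffOn.log fun t ht => (sub_neg.2 ht.2).ne))
  have hlogc : ContDiffOn ℝ 1 (fun t => (logSolution a t : ℂ)) (Ioo (-a) a) :=
    Complex.ofRealCLM.contDiff.comp_contDiffOn hlog
  have hid : ContDiffOn ℝ 1 (fun t : ℝ => (t : ℂ)) (Ioo (-a) a) :=
    Complex.ofRealCLM.contDiff.contDiffOn
  have hweight : ContDiffOn ℝ 1 (fun t => (weight a t : ℂ)) (Ioo (-a) a) :=
    Complex.ofRealCLM.contDiff.comp_contDiffOn ((contDiff_weight a).of_le (by simp)).contDiffOn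
  exact .of_contDiffOn ((hweight.mul (contDiffOn_const.add (contDiffOn_const.mul hlogc))).add
    (contDiffOn_const.add (contDiffOn_const.mul hid)))

theorem inMaxDomain_affineLog (a : ℝ) : InMaxDomain a (affineLog a A₀ A₁ B₀ B₁) := by
  have hcont (p q : ℂ) : Continuous fun t : ℝ => p + q * (t : ℂ) := by fun_prop
  have hlog : MemLp (fun t => (logSolution a t : ℂ)) 2 (mu a) := (memLp_logSolution a).ofReal
  have hslope : Continuous fun t : ℝ => 2 * (t : ℂ) / (a : ℂ) ^ 2 := by fun_prop
  have hmem : MemLp (affineLog a A₀ A₁ B₀ B₁) 2 (mu a) :=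
    ((memLp_top_of_continuous a (hcont A₀ A₁)).mono_exponent le_top).add
      (memLp_continuous_mul (hcont B₀ B₁) hlog)
  have hderiv : MemLp (fun t : ℝ => 2 * B₁ - 2 * t / a ^ 2 * (A₁ + B₁ * logSolution a t)) 2
      (mu a) :=
    (memLp_const (2 * B₁)).sub
      (memLp_continuous_mul hslope ((memLp_const A₁).add (hlog.const_mul B₁)))
  exact .of_hasDerivAt (locallyAC_affineLogFlux A₁ B₀ B₁)
    (fun t ht => hasDerivAt_affineLog A₀ A₁ B₀ B₁ ht)
    (.of_forall fun t ht => hasDerivAt_affineLogFlux A₁ B₀ B₁ ht) hmem hderiv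

theorem flux_affineLog {t : ℝ} (ht : t ∈ Ioo (-a) a) :
    flux a (affineLog a A₀ A₁ B₀ B₁) t = affineLogFlux a A₁ B₀ B₁ t :=
  flux_eq_of_hasDerivAt ht (hasDerivAt_affineLog A₀ A₁ B₀ B₁ ht)

theorem affineLog_neg_left (a : ℝ) : affineLog (-a) A₀ A₁ B₀ B₁ = affineLog a A₀ A₁ B₀ B₁ := by
  ext t
  rw [affineLog, affineLog, logSolution_neg_left]

theorem affineLogFlux_neg_left (a : ℝ) :
    affineLogFlux (-a) A₁ B₀ B₁ = affineLogFlux a A₁ B₀ B₁ := by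
  ext t
  rw [affineLogFlux, affineLogFlux, logSolution_neg_left, weight_neg_left]

theorem hasEndpointValues_affineLog {e : ℝ} {l : Filter ℝ} (he : e ≠ 0) (hl : l ≤ 𝓝[≠] e)
    (hflux : flux e (affineLog e A₀ A₁ B₀ B₁) =ᶠ[l] affineLogFlux e A₁ B₀ B₁) :
    HasEndpointValues e l (affineLog e A₀ A₁ B₀ B₁) (-(e / 2 * (B₀ + B₁ * e)))
      (-(A₀ + A₁ * e) - e / 2 * Real.log (2 * e) * (B₀ + B₁ * e)) := by
  have hweight := ((tendsto_weight he).mono_left hl).ofReal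
  have hlog := ((tendsto_weight_mul_logSolution he).mono_left hl).ofReal
  have hlogsq := ((tendsto_weight_mul_logSolution_sq he).mono_left hl).ofReal
  have haffine (p q : ℂ) : Tendsto (fun t : ℝ => p + q * (t : ℂ)) l (𝓝 (p + q * e)) :=
    (Continuous.tendsto (by fun_prop) e).mono_left (hl.trans nhdsWithin_le_nhds)
  refine .of_tendsto_flux he hl ?_ ?_
  · have h := ((hweight.mul_const A₁).add (hlog.mul_const B₁)).add (haffine B₀ B₁)
    simp only [Complex.ofReal_zero, zero_mul, zero_add] at h
    refine h.congr' (hflux.mono fun t ht => ?_)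
    rw [ht, affineLogFlux]
    push_cast
    ring
  · have h := ((hlog.mul_const A₁).add (hlogsq.mul_const B₁)).sub (haffine A₀ A₁)
    simp only [Complex.ofReal_zero, zero_mul, zero_add, zero_sub] at h
    refine h.congr' (hflux.mono fun t ht => ?_)
    simp only [ht, affineLogFlux, affineLog]
    push_cast
    ring

end AffineLog

section BoundaryValues

variable {a : ℝ}

theorem nhdsWithin_Ioo_le_nhdsNE_left (a : ℝ) : 𝓝[Ioo (-a) a] (-a) ≤ 𝓝[≠] (-a) :=
  nhdsWithin_mono _ fun _ ht => ht.1.ne'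

theorem nhdsWithin_Ioo_le_nhdsNE_right (a : ℝ) : 𝓝[Ioo (-a) a] a ≤ 𝓝[≠] a :=
  nhdsWithin_mono _ fun _ ht => ht.2.ne

theorem hasBoundaryValues_affineLog (ha : a ≠ 0) (A₀ A₁ B₀ B₁ : ℂ) :
    HasBoundaryValues a (affineLog a A₀ A₁ B₀ B₁)
      (a / 2 * (B₀ - B₁ * a))
      (-(A₀ - A₁ * a) + a / 2 * Real.log (2 * a) * (B₀ - B₁ * a))
      (-(a / 2 * (B₀ + B₁ * a)))
      (-(A₀ + A₁ * a) - a / 2 * Real.log (2 * a) * (B₀ + B₁ * a)) := by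
  have hflux (e : ℝ) : flux a (affineLog a A₀ A₁ B₀ B₁) =ᶠ[𝓝[Ioo (-a) a] e]
      affineLogFlux a A₁ B₀ B₁ :=
    eventually_nhdsWithin_of_forall fun t ht => flux_affineLog A₀ A₁ B₀ B₁ ht
  have hleft := hasEndpointValues_affineLog A₀ A₁ B₀ B₁ (neg_ne_zero.2 ha)
    (nhdsWithin_Ioo_le_nhdsNE_left a)
    (by simpa only [affineLog_neg_left, affineLogFlux_neg_left, flux_neg_left] using hflux (-a))
  have hright := hasEndpointValues_affineLog A₀ A₁ B₀ B₁ ha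
    (nhdsWithin_Ioo_le_nhdsNE_right a) (hflux a)
  rw [affineLog_neg_left, mul_neg, Real.log_neg_eq_log, Complex.ofReal_neg] at hleft
  refine hasBoundaryValues_iff.2 ⟨?_, hright⟩
  convert hleft using 1 <;> ring

theorem exists_affine_eq (ha : a ≠ 0) (p q : ℂ) :
    ∃ A₀ A₁ : ℂ, A₀ - A₁ * a = p ∧ A₀ + A₁ * a = q := by
  have ha' : (a : ℂ) ≠ 0 := Complex.ofReal_ne_zero.2 ha
  refine ⟨(p + q) / 2, (q - p) / (2 * a), ?_, ?_⟩ <;> field_simp <;> ring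

theorem exists_inMaxDomain_hasBoundaryValues (ha : a ≠ 0) (bm cm bp cp : ℂ) :
    ∃ x, InMaxDomain a x ∧ HasBoundaryValues a x bm cm bp cp := by
  have ha' : (a : ℂ) ≠ 0 := Complex.ofReal_ne_zero.2 ha
  obtain ⟨A₀, A₁, hAl, hAr⟩ := exists_affine_eq ha
    (Real.log (2 * a) * bm - cm) (Real.log (2 * a) * bp - cp)
  obtain ⟨B₀, B₁, hBl, hBr⟩ := exists_affine_eq ha (2 / a * bm) (-(2 / a * bp))
  refine ⟨_, inMaxDomain_affineLog A₀ A₁ B₀ B₁ a, ?_⟩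
  convert hasBoundaryValues_affineLog ha A₀ A₁ B₀ B₁ using 1 <;>
    simp only [hAl, hAr, hBl, hBr] <;> field_simp <;> ring

namespace InMaxDomain

variable {x y : ℝ → ℂ}

/- The Wronskians of `x` with the solutions `1` and `logSolution a` of `((1 - t² / a²) y')' = 0`
are `flux a x` and `logSolution a * flux a x - x`. -/
theorem exists_hasBoundaryValues (ha : 0 < a) (hx : InMaxDomain a x) :
    ∃ bm cm bp cp, HasBoundaryValues a x bm cm bp cp := by
  have hWone : EqOn (wronskian a (affineLog a 1 0 0 0) x) (flux a x) (Ioo (-a) a) := fun t ht => by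
    simp [wronskian, flux_affineLog 1 0 0 0 ht, affineLog, affineLogFlux]
  have hWlog : EqOn (wronskian a (affineLog a 0 0 1 0) x)
      (fun t => (logSolution a t : ℂ) * flux a x t - x t) (Ioo (-a) a) := fun t ht => by
    simp [wronskian, flux_affineLog 0 0 1 0 ht, affineLog, affineLogFlux]
  obtain ⟨βl, βr, hβl, hβr, -⟩ := (inMaxDomain_affineLog 1 0 0 0 a).exists_tendsto_wronskian ha hx
  obtain ⟨γl, γr, hγl, hγr, -⟩ := (inMaxDomain_affineLog 0 0 1 0 a).exists_tendsto_wronskian ha hx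
  have hevent {f g : ℝ → ℂ} (h : EqOn f g (Ioo (-a) a)) (e : ℝ) : f =ᶠ[𝓝[Ioo (-a) a] e] g :=
    h.eventuallyEq_nhdsWithin
  have hright := HasEndpointValues.of_tendsto_flux ha.ne' (nhdsWithin_Ioo_le_nhdsNE_right a)
    (hβr.congr' (hevent hWone a)) (hγr.congr' (hevent hWlog a))
  have hleft := HasEndpointValues.of_tendsto_flux (neg_ne_zero.2 ha.ne')
    (nhdsWithin_Ioo_le_nhdsNE_left a) (x := x)
    (by simpa only [flux_neg_left] using hβl.congr' (hevent hWone (-a)))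
    (by simpa only [flux_neg_left, logSolution_neg_left] using hγl.congr' (hevent hWlog (-a)))
  exact ⟨_, _, _, _, hasBoundaryValues_iff.2 ⟨hleft, hright⟩⟩

theorem integral_formalL_sub_eq (ha : 0 < a) (hx : InMaxDomain a x) (hy : InMaxDomain a y)
    {bm cm bp cp bm' cm' bp' cp' : ℂ} (hxb : HasBoundaryValues a x bm cm bp cp)
    (hyb : HasBoundaryValues a y bm' cm' bp' cp') :
    ∫ t, (conj (formalL a x t) * y t - conj (x t) * formalL a y t) ∂mu a =
      -(2 / a) * ((conj bm * cm' - conj cm * bm') + (conj bp * cp' - conj cp * bp')) := by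
  obtain ⟨l, r, hl, hr, heq⟩ := hx.exists_tendsto_wronskian ha hy
  obtain ⟨hxl, hxr⟩ := hasBoundaryValues_iff.1 hxb
  obtain ⟨hyl, hyr⟩ := hasBoundaryValues_iff.1 hyb
  have hlt : -a < a := neg_lt_self ha
  have := left_nhdsWithin_Ioo_neBot hlt
  have := right_nhdsWithin_Ioo_neBot hlt
  rw [heq, tendsto_nhds_unique hr
      (hxr.tendsto_wronskian ha.ne' (nhdsWithin_Ioo_le_nhdsNE_right a) hyr),
    tendsto_nhds_unique hl (by
      simpa only [wronskian_neg_left] using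
        hxl.tendsto_wronskian (neg_ne_zero.2 ha.ne') (nhdsWithin_Ioo_le_nhdsNE_left a) hyl)]
  push_cast
  ring

end InMaxDomain

theorem hasBoundaryValues_unique (ha : 0 < a) {x : ℝ → ℂ} {bm cm bp cp bm' cm' bp' cp' : ℂ}
    (h : HasBoundaryValues a x bm cm bp cp) (h' : HasBoundaryValues a x bm' cm' bp' cp') :
    bm = bm' ∧ cm = cm' ∧ bp = bp' ∧ cp = cp' := by
  have := left_nhdsWithin_Ioo_neBot (neg_lt_self ha)
  have := right_nhdsWithin_Ioo_neBot (neg_lt_self ha)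
  obtain ⟨hl, hr⟩ := hasBoundaryValues_iff.1 h
  obtain ⟨hl', hr'⟩ := hasBoundaryValues_iff.1 h'
  exact ⟨(hl.unique hl').1, (hl.unique hl').2, (hr.unique hr').1, (hr.unique hr').2⟩

end BoundaryValues

section ParticularSolution

/-- The solution of `((1 - t² / a²) x')' = f` with vanishing Cauchy data at `c`. -/
def particularSolution (a c : ℝ) (f : ℝ → ℂ) (t : ℝ) : ℂ :=
  ∫ s in c..t, (∫ r in c..s, f r) / (weight a s : ℂ)

variable {a c : ℝ} {f : ℝ → ℂ}

theorem locallyAC_integral {α β : ℝ} (hf : IntegrableOn f (Ioo α β)) (hc : c ∈ Ioo α β) :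
    LocallyAC (fun t => ∫ s in c..t, f s) (Ioo α β) := fun p q hpq hs => by
  have hαβ : α ≤ β := (hc.1.trans hc.2).le
  have hf' := (intervalIntegrable_iff_integrableOn_Ioo_of_le hαβ).2 hf
  have hmem : c ∈ uIcc α β := by
    rw [uIcc_of_le hαβ]
    exact Ioo_subset_Icc_self hc
  refine (ac_intervalIntegral hf' hmem).mono ?_
  rw [uIcc_of_le hαβ, uIcc_of_le hpq]
  exact hs.trans Ioo_subset_Icc_self

theorem ae_hasDerivAt_integral {α β : ℝ} (hf : IntegrableOn f (Ioo α β)) (hc : c ∈ Ioo α β) :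
    ∀ᵐ t, t ∈ Ioo α β → HasDerivAt (fun t => ∫ s in c..t, f s) (f t) t := by
  have hαβ : α ≤ β := (hc.1.trans hc.2).le
  have hf' := (intervalIntegrable_iff_integrableOn_Ioo_of_le hαβ).2 hf
  filter_upwards [hf'.ae_hasDerivAt_integral] with t ht htI
  rw [uIcc_of_le hαβ] at ht
  exact ht (Ioo_subset_Icc_self htI) c (Ioo_subset_Icc_self hc)

theorem hasDerivAt_integral_of_continuousOn {s : Set ℝ} (hs : IsOpen s) (hs' : OrdConnected s)
    (hf : ContinuousOn f s) (hc : c ∈ s) {t : ℝ} (ht : t ∈ s) :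
    HasDerivAt (fun t => ∫ s in c..t, f s) (f t) t :=
  intervalIntegral.integral_hasDerivAt_right (hf.mono (hs'.uIcc_subset hc ht)).intervalIntegrable
    (hf.stronglyMeasurableAtFilter hs t ht) (hf.continuousAt (hs.mem_nhds ht))

theorem hasDerivAt_particularSolution (hf : IntegrableOn f (Ioo (-a) a)) (hc : c ∈ Ioo (-a) a)
    {t : ℝ} (ht : t ∈ Ioo (-a) a) :
    HasDerivAt (particularSolution a c f) ((∫ s in c..t, f s) / (weight a t : ℂ)) t := by
  have hweight : Continuous fun t => (weight a t : ℂ) :=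
    Complex.continuous_ofReal.comp (contDiff_weight a).continuous
  exact hasDerivAt_integral_of_continuousOn isOpen_Ioo ordConnected_Ioo
    (((locallyAC_integral hf hc).continuousOn isOpen_Ioo).div hweight.continuousOn
      fun s hs => Complex.ofReal_ne_zero.2 (weight_pos hs).ne') hc ht

theorem norm_particularSolution_le (hf : IntegrableOn f (Ioo (-a) a)) (hc : c ∈ Ioo (-a) a)
    {t : ℝ} (ht : t ∈ Ioo (-a) a) :
    ‖particularSolution a c f t‖ ≤
      (∫ s in Ioo (-a) a, ‖f s‖) * ‖logSolution a t - logSolution a c‖ := by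
  have hsub {s : ℝ} (hs : s ∈ Ioo (-a) a) : uIcc c s ⊆ Ioo (-a) a :=
    ordConnected_Ioo.uIcc_subset hc hs
  have hinv : ContinuousOn (fun s => (weight a s)⁻¹) (Ioo (-a) a) :=
    (contDiff_weight a).continuous.continuousOn.inv₀ fun s hs => (weight_pos hs).ne'
  have hint : IntervalIntegrable (fun s => (weight a s)⁻¹) volume c t :=
    (hinv.mono (hsub ht)).intervalIntegrable
  have hlog : ∫ s in c..t, (weight a s)⁻¹ = logSolution a t - logSolution a c :=
    intervalIntegral.integral_eq_sub_of_hasDerivAt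
      (fun s hs => hasDerivAt_logSolution (hsub ht hs)) hint
  have hF {s : ℝ} (hs : s ∈ Ioo (-a) a) : ‖∫ r in c..s, f r‖ ≤ ∫ s in Ioo (-a) a, ‖f s‖ :=
    intervalIntegral.norm_integral_le_integral_norm_uIoc.trans <|
      setIntegral_mono_set hf.norm (.of_forall fun _ => norm_nonneg _)
        (uIoc_subset_uIcc.trans (hsub hs)).eventuallyLE
  rw [← hlog, Real.norm_eq_abs,
    ← abs_of_nonneg (integral_nonneg (μ := mu a) fun s => norm_nonneg (f s)),
    ← abs_mul, ← intervalIntegral.integral_const_mul]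
  refine intervalIntegral.norm_integral_le_abs_of_norm_le ?_ (hint.const_mul _)
  filter_upwards [ae_restrict_mem measurableSet_uIoc] with s hs
  have hsI := hsub ht (uIoc_subset_uIcc hs)
  rw [norm_div, Complex.norm_real, Real.norm_of_nonneg (weight_pos hsI).le, div_eq_mul_inv]
  exact mul_le_mul_of_nonneg_right (hF hsI) (inv_nonneg.2 (weight_pos hsI).le)

theorem inMaxDomain_particularSolution (hf : MemLp f 2 (mu a)) (hc : c ∈ Ioo (-a) a) :
    InMaxDomain a (particularSolution a c f) := by
  have hfi : IntegrableOn f (Ioo (-a) a) := hf.integrable one_le_two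
  have hderiv {t : ℝ} (ht : t ∈ Ioo (-a) a) := hasDerivAt_particularSolution hfi hc ht
  have hmeas : AEStronglyMeasurable (particularSolution a c f) (mu a) :=
    ContinuousOn.aestronglyMeasurable
      (fun t ht => (hderiv ht).continuousAt.continuousWithinAt) measurableSet_Ioo
  have hlog : MemLp (fun t => logSolution a t - logSolution a c) 2 (mu a) :=
    (memLp_logSolution a).sub (memLp_const (logSolution a c))
  exact .of_hasDerivAt (locallyAC_integral hfi hc) (fun t ht => hderiv ht)
    (ae_hasDerivAt_integral hfi hc) (hlog.of_le_mul hmeas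
      (ae_restrict_of_forall_mem measurableSet_Ioo fun t ht =>
        norm_particularSolution_le hfi hc ht)) hf

theorem formalL_particularSolution (hf : IntegrableOn f (Ioo (-a) a)) (hc : c ∈ Ioo (-a) a) :
    formalL a (particularSolution a c f) =ᵐ[mu a]
      fun t => -f t + ((t ^ 2 : ℝ) : ℂ) * particularSolution a c f t := by
  filter_upwards [(ae_restrict_iff' measurableSet_Ioo).2 (ae_hasDerivAt_integral hf hc),
    ae_restrict_mem measurableSet_Ioo] with t hft ht
  exact formalL_eq_of_hasDerivAt ht (fun s hs => hasDerivAt_particularSolution hf hc hs) hft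

theorem particularSolution_eq (hf : Continuous f) (hc : c ∈ Ioo (-a) a) {t : ℝ}
    (ht : t ∈ Ioo (-a) a) :
    particularSolution a c f t =
      (∫ s in c..t, f s) * logSolution a t - ∫ s in c..t, f s * logSolution a s := by
  have hsub : uIcc c t ⊆ Ioo (-a) a := ordConnected_Ioo.uIcc_subset hc ht
  have hinv : ContinuousOn (fun s => (((weight a s)⁻¹ : ℝ) : ℂ)) (uIcc c t) :=
    Complex.continuous_ofReal.comp_continuousOn <|
      (contDiff_weight a).continuous.continuousOn.inv₀ fun s hs => (weight_pos (hsub hs)).ne'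
  have hparts := intervalIntegral.integral_mul_deriv_eq_deriv_mul
    (fun s _ => hf.integral_hasStrictDerivAt c s |>.hasDerivAt)
    (fun s hs => (hasDerivAt_logSolution (hsub hs)).ofReal_comp)
    (hf.intervalIntegrable c t) hinv.intervalIntegrable
  simp only [intervalIntegral.integral_same, zero_mul, sub_zero] at hparts
  simpa only [particularSolution, div_eq_mul_inv, Complex.ofReal_inv] using hparts

end ParticularSolution

section Core

variable {a : ℝ} {f x y w : ℝ → ℂ}

theorem exists_subset_Ioc_of_isCompact {K : Set ℝ} {p q : ℝ} (hK : IsCompact K) (hpq : p < q)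
    (hKs : K ⊆ Ioo p q) : ∃ α β, p < α ∧ α ≤ β ∧ β < q ∧ K ⊆ Ioc α β := by
  obtain ⟨c, hpc, hcq⟩ := exists_between hpq
  obtain ⟨p', hp', hKp⟩ := hK.exists_forall_le' continuousOn_id fun t ht => (hKs ht).1
  obtain ⟨q', hq', hKq⟩ := hK.exists_forall_le' continuousOn_neg fun t ht =>
    neg_lt_neg (hKs ht).2
  obtain ⟨α, hpα, hα⟩ := exists_between (lt_min hp' hpc)
  exact ⟨α, max (-q') c, hpα, (hα.trans_le (min_le_right _ _)).le.trans (le_max_right _ _),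
    max_lt (neg_lt.1 hq') hcq, fun t ht => ⟨hα.trans_le ((min_le_left _ _).trans (hKp t ht)),
      (le_neg_of_le_neg (hKq t ht)).trans (le_max_left _ _)⟩⟩

theorem intervalIntegral_eq_zero_of_notMem_Ioc {α β t : ℝ} (hf : Function.support f ⊆ Ioc α β)
    (h0 : ∫ s, f s = 0) (ht : t ∉ Ioc α β) : ∫ s in α..t, f s = 0 := by
  rcases le_or_gt t α with htα | hαt
  · refine intervalIntegral.integral_zero_ae (.of_forall fun s hs => ?_)
    rw [uIoc_of_ge htα] at hs
    exact Function.notMem_support.1 fun hsf => (hf hsf).1.not_ge hs.2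
  · have hβt : β < t := lt_of_not_ge fun h => ht ⟨hαt, h⟩
    rw [intervalIntegral.integral_eq_integral_of_support_subset
      (hf.trans (Ioc_subset_Ioc_right hβt.le)), h0]

theorem classA₀_particularSolution {α β : ℝ} (hα : -a < α) (hαβ : α ≤ β) (hβ : β < a)
    (hf : Continuous f) (hsupp : Function.support f ⊆ Ioc α β) (h0 : ∫ t, f t = 0)
    (h1 : ∫ t, f t * logSolution a t = 0) : ClassA₀ a (particularSolution a α f) := by
  have hfLp : MemLp f 2 (mu a) := (memLp_top_of_continuous a hf).mono_exponent le_top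
  have hαI : α ∈ Ioo (-a) a := ⟨hα, hαβ.trans_lt hβ⟩
  refine ⟨(inMaxDomain_particularSolution hfLp hαI).classA, Icc α β, isCompact_Icc,
    Icc_subset_Ioo hα hβ, fun t ht htK => ?_⟩
  have htK' : t ∉ Ioc α β := fun h => htK (Ioc_subset_Icc_self h)
  rw [particularSolution_eq hf hαI ht, intervalIntegral_eq_zero_of_notMem_Ioc hsupp h0 htK',
    intervalIntegral_eq_zero_of_notMem_Ioc
      ((Function.support_mul_subset_left _ _).trans hsupp) h1 htK', zero_mul, sub_zero]

theorem ClassA₀.hasEndpointValues (hx : ClassA₀ a x) {e : ℝ} (he : e ∉ Ioo (-a) a) :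
    HasEndpointValues e (𝓝[Ioo (-a) a] e) x 0 0 := by
  obtain ⟨K, hK, hKI, hxK⟩ := hx.supp
  have hzero : ∀ᶠ t in 𝓝[Ioo (-a) a] e, x t = 0 ∧ deriv x t = 0 := by
    filter_upwards [self_mem_nhdsWithin, nhdsWithin_le_nhds
      (hK.isClosed.isOpen_compl.mem_nhds fun h => he (hKI h))] with t ht htK
    have hxt : x =ᶠ[𝓝 t] fun _ => 0 := by
      filter_upwards [isOpen_Ioo.mem_nhds ht, hK.isClosed.isOpen_compl.mem_nhds htK] with s hs hsK
        using hxK s hs hsK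
    exact ⟨hxt.self_of_nhds, by rw [hxt.deriv_eq, deriv_const]⟩
  constructor <;> refine tendsto_const_nhds.congr' ?_ <;> filter_upwards [hzero] with t ht
  · rw [ht.2, mul_zero]
  · rw [ht.1, ht.2, mul_zero, sub_zero]

theorem ClassA₀.hasBoundaryValues (hx : ClassA₀ a x) : HasBoundaryValues a x 0 0 0 0 :=
  hasBoundaryValues_iff.2
    ⟨hx.hasEndpointValues left_notMem_Ioo, hx.hasEndpointValues right_notMem_Ioo⟩

/-- `(u, v)` satisfies the Lagrange identity without boundary terms against all functions of the
core, that is, `v = L u` weakly. -/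
def IsWeakSolution (a : ℝ) (u v : ℝ → ℂ) : Prop :=
  ∀ φ, ClassA₀ a φ → InMaxDomain a φ →
    ∫ t, conj (formalL a φ t) * u t ∂mu a = ∫ t, conj (φ t) * v t ∂mu a

theorem InMaxDomain.isWeakSolution (ha : 0 < a) (hx : InMaxDomain a x) :
    IsWeakSolution a x (formalL a x) := fun φ hφ hφL => by
  obtain ⟨bm, cm, bp, cp, hxb⟩ := hx.exists_hasBoundaryValues ha
  have hgreen := hφL.integral_formalL_sub_eq ha hx hφ.hasBoundaryValues hxb
  rw [← sub_eq_zero, ← integral_sub, hgreen]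
  · simp only [map_zero, zero_mul, sub_zero, add_zero, mul_zero]
  · exact hφL.memLp_formalL.star.integrable_mul hx.memLp
  · exact hφL.memLp.star.integrable_mul hx.memLp_formalL

theorem IsWeakSolution.sub {u v u' v' : ℝ → ℂ} (h : IsWeakSolution a u v)
    (h' : IsWeakSolution a u' v') (hu : MemLp u 2 (mu a)) (hv : MemLp v 2 (mu a))
    (hu' : MemLp u' 2 (mu a)) (hv' : MemLp v' 2 (mu a)) :
    IsWeakSolution a (u - u') (v - v') := fun φ hφ hφL => by
  simp only [Pi.sub_apply, mul_sub]
  rw [integral_sub, integral_sub, h φ hφ hφL, h' φ hφ hφL]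
  exacts [hφL.memLp.star.integrable_mul hv, hφL.memLp.star.integrable_mul hv',
    hφL.memLp_formalL.star.integrable_mul hu, hφL.memLp_formalL.star.integrable_mul hu']

theorem IsWeakSolution.congr {u v u' v' : ℝ → ℂ} (h : IsWeakSolution a u v)
    (hu : u =ᵐ[mu a] u') (hv : v =ᵐ[mu a] v') : IsWeakSolution a u' v' := fun φ hφ hφL => by
  rw [← integral_congr_ae (hu.mono fun t ht => congrArg (conj (formalL a φ t) * ·) ht),
    ← integral_congr_ae (hv.mono fun t ht => congrArg (conj (φ t) * ·) ht), h φ hφ hφL]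

theorem IsWeakSolution.testIntegral_eq_zero (hlt : -a < a) (hw : MemLp w 2 (mu a))
    (h : IsWeakSolution a w fun t => ((t ^ 2 : ℝ) : ℂ) * w t) {φ : ℝ → ℂ}
    (hφ : φ ∈ testFunctions ℂ (Ioo (-a) a)) (h0 : ∫ t, φ t ∂mu a = 0)
    (h1 : ∫ t, φ t * logSolution a t ∂mu a = 0) : ∫ t, φ t * w t ∂mu a = 0 := by
  obtain ⟨hφc, hφK, hφI⟩ := hφ
  obtain ⟨α, β, hα, hαβ, hβ, hφαβ⟩ := exists_subset_Ioc_of_isCompact hφK hlt hφI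
  have hf : Continuous fun t => conj (φ t) := Complex.continuous_conj.comp hφc
  have hvol {g : ℝ → ℂ} (hg : ∫ t, φ t * g t ∂mu a = 0) : ∫ t, φ t * g t = 0 := by
    rw [← hg, setIntegral_eq_integral_of_forall_compl_eq_zero fun t ht => ?_]
    rw [image_eq_zero_of_notMem_tsupport fun h => ht (hφI h), zero_mul]
  have hf0 : ∫ t, conj (φ t) = 0 := by
    rw [integral_conj, show ∫ t, φ t = 0 by simpa using hvol (g := 1) (by simpa using h0), map_zero]
  have hf1 : ∫ t, conj (φ t) * logSolution a t = 0 := by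
    rw [← map_zero conj, ← hvol h1, ← integral_conj]
    simp only [map_mul, Complex.conj_ofReal]
  have hsupp : (Function.support fun t => conj (φ t)) ⊆ Ioc α β := fun t ht =>
    hφαβ (subset_tsupport φ fun h => ht (by simp [h]))
  have hαI : α ∈ Ioo (-a) a := ⟨hα, hαβ.trans_lt hβ⟩
  have hfLp : MemLp (fun t => conj (φ t)) 2 (mu a) :=
    (memLp_top_of_continuous a hf).mono_exponent le_top
  have hx := inMaxDomain_particularSolution hfLp hαI
  have hx₀ := classA₀_particularSolution hα hαβ hβ hf hsupp hf0 hf1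
  rw [← sub_eq_zero.2 (h _ hx₀ hx).symm, ← integral_sub]
  · refine integral_congr_ae ?_
    filter_upwards [formalL_particularSolution (hfLp.integrable one_le_two) hαI] with t ht
    rw [ht]
    simp only [map_add, map_neg, map_mul, Complex.conj_conj, Complex.conj_ofReal]
    ring
  · exact hx.memLp.star.integrable_mul
      (memLp_continuous_mul (g := fun t => ((t ^ 2 : ℝ) : ℂ)) (by fun_prop) hw)
  · exact hx.memLp_formalL.star.integrable_mul hw

theorem IsWeakSolution.exists_ae_eq_affineLog (ha : 0 < a) (hw : MemLp w 2 (mu a))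
    (h : IsWeakSolution a w fun t => ((t ^ 2 : ℝ) : ℂ) * w t) :
    ∃ A B, w =ᵐ[mu a] affineLog a A 0 B 0 := by
  have hlog : MemLp (fun t => (logSolution a t : ℂ)) 2 (mu a) := (memLp_logSolution a).ofReal
  have hloc {g : ℝ → ℂ} (hg : MemLp g 2 (mu a)) : LocallyIntegrableOn g (Ioo (-a) a) (mu a) :=
    (hg.integrable one_le_two).locallyIntegrable.locallyIntegrableOn _
  obtain ⟨c, hc⟩ := exists_ae_eq_sum_of_testIntegral_eq_zero isOpen_Ioo (hloc hw)
    (w := ![fun _ => 1, fun t => (logSolution a t : ℂ)])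
    (Fin.forall_fin_two.2 ⟨hloc (memLp_const 1), hloc hlog⟩) fun φ hφ hφw =>
      h.testIntegral_eq_zero (neg_lt_self ha) hw hφ (by simpa using hφw 0) (hφw 1)
  refine ⟨c 0, c 1, ?_⟩
  filter_upwards [hc, ae_restrict_mem measurableSet_Ioo] with t hct ht
  simpa [Fin.sum_univ_two, affineLog] using hct ht

theorem formalL_affineLog (A B : ℂ) (a : ℝ) :
    formalL a (affineLog a A 0 B 0) =ᵐ[mu a] fun t =>
      ((t ^ 2 : ℝ) : ℂ) * affineLog a A 0 B 0 t := by
  filter_upwards [ae_restrict_mem measurableSet_Ioo] with t ht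
  rw [formalL_eq_of_hasDerivAt ht (fun s hs => hasDerivAt_affineLog A 0 B 0 hs)
    (hasDerivAt_affineLogFlux 0 B 0 ht)]
  ring

theorem InMaxDomain.add (hx : InMaxDomain a x) (hy : InMaxDomain a y) : InMaxDomain a (x + y) :=
  ⟨hx.classA.add hy.classA, hx.memLp.add hy.memLp,
    (hx.memLp_formalL.add hy.memLp_formalL).ae_eq (formalL_add hx.classA hy.classA).symm⟩

theorem IsWeakSolution.exists_inMaxDomain (ha : 0 < a) {u v : ℝ → ℂ} (h : IsWeakSolution a u v)
    (hu : MemLp u 2 (mu a)) (hv : MemLp v 2 (mu a)) :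
    ∃ x, InMaxDomain a x ∧ u =ᵐ[mu a] x ∧ v =ᵐ[mu a] formalL a x := by
  have hsq {g : ℝ → ℂ} (hg : MemLp g 2 (mu a)) :
      MemLp (fun t => ((t ^ 2 : ℝ) : ℂ) * g t) 2 (mu a) :=
    memLp_continuous_mul (by fun_prop) hg
  have hfLp := (hsq hu).sub hv
  set y := particularSolution a 0 ((fun t => ((t ^ 2 : ℝ) : ℂ) * u t) - v)
  have h0 : (0 : ℝ) ∈ Ioo (-a) a := ⟨neg_lt_zero.2 ha, ha⟩
  have hy : InMaxDomain a y := inMaxDomain_particularSolution hfLp h0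
  have hLy : formalL a y =ᵐ[mu a] fun t =>
      -(((t ^ 2 : ℝ) : ℂ) * u t - v t) + ((t ^ 2 : ℝ) : ℂ) * y t :=
    formalL_particularSolution (hfLp.integrable one_le_two) h0
  have hw : IsWeakSolution a (u - y) fun t => ((t ^ 2 : ℝ) : ℂ) * (u - y) t :=
    (h.sub (hy.isWeakSolution ha) hu hv hy.memLp hy.memLp_formalL).congr .rfl <| by
      filter_upwards [hLy] with t ht
      simp only [Pi.sub_apply, ht]
      ring
  obtain ⟨A, B, hAB⟩ := hw.exists_ae_eq_affineLog ha (hu.sub hy.memLp)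
  have hz := inMaxDomain_affineLog A 0 B 0 a
  have hu' : u =ᵐ[mu a] y + affineLog a A 0 B 0 := by
    filter_upwards [hAB] with t ht
    rw [Pi.add_apply, ← ht, Pi.sub_apply, add_sub_cancel]
  refine ⟨y + affineLog a A 0 B 0, hy.add hz, hu', ?_⟩
  filter_upwards [hu', hLy, formalL_affineLog A B a, formalL_add hy.classA hz.classA]
    with t hut hyt hzt hLt
  rw [hLt, Pi.add_apply, hyt, hzt, hut, Pi.add_apply]
  ring

end Core

section Adjoint

theorem inner_eq_integral {α : Type*} [MeasurableSpace α] {μ : Measure α} {u v : Lp ℂ 2 μ}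
    {x y : α → ℂ} (hu : u =ᵐ[μ] x) (hv : v =ᵐ[μ] y) :
    ⟪u, v⟫_ℂ = ∫ t, conj (x t) * y t ∂μ := by
  rw [L2.inner_def]
  refine integral_congr_ae ?_
  filter_upwards [hu, hv] with t hut hvt
  rw [hut, hvt, RCLike.inner_apply, mul_comm]

variable {a : ℝ} {x : ℝ → ℂ}

theorem Lmax_ae_eq {u : (Lmax a).domain} (hx : ClassA a x) (hux : (u : H a) =ᵐ[mu a] x) :
    Lmax a u =ᵐ[mu a] formalL a x := by
  have hu : ((u : H a), Lmax a u) ∈ maxGraph a := graph_Lmax a ▸ (Lmax a).mem_graph u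
  obtain ⟨y, hy, huy, hLy⟩ := hu
  filter_upwards [hLy, ae_restrict_mem measurableSet_Ioo] with t htL ht
  rw [htL, formalL_congr (hx.eqOn_of_ae hy (hux.symm.trans huy)) ht]

theorem ClassA.inMaxDomain {u : (Lmax a).domain} (hx : ClassA a x)
    (hux : (u : H a) =ᵐ[mu a] x) : InMaxDomain a x :=
  ⟨hx, (Lp.memLp (u : H a)).ae_eq hux, (Lp.memLp (Lmax a u)).ae_eq (Lmax_ae_eq hx hux)⟩

theorem exists_inMaxDomain_ae_eq (u : (Lmax a).domain) :
    ∃ x, InMaxDomain a x ∧ (u : H a) =ᵐ[mu a] x := by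
  have hu : ((u : H a), Lmax a u) ∈ maxGraph a := graph_Lmax a ▸ (Lmax a).mem_graph u
  obtain ⟨x, hx, hux, -⟩ := hu
  exact ⟨x, hx.inMaxDomain hux, hux⟩

theorem InMaxDomain.mem_graph_Lmax (hx : InMaxDomain a x) {u v : H a} (hu : u =ᵐ[mu a] x)
    (hv : v =ᵐ[mu a] formalL a x) : (u, v) ∈ (Lmax a).graph := by
  rw [graph_Lmax]
  exact ⟨x, hx.classA, hu, hv⟩

theorem InMaxDomain.toLp_mem_domain (hx : InMaxDomain a x) :
    hx.memLp.toLp x ∈ (Lmax a).domain :=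
  LinearPMap.mem_domain_of_mem_graph
    (hx.mem_graph_Lmax hx.memLp.coeFn_toLp hx.memLp_formalL.coeFn_toLp)

theorem isWeakSolution_iff {u v : H a} :
    IsWeakSolution a u v ↔ ∀ w : (Lcore a).domain, ⟪Lcore a w, u⟫_ℂ = ⟪(w : H a), v⟫_ℂ := by
  have hLcore (w : (Lcore a).domain) : Lcore a w = Lmax a ⟨w, w.2.2⟩ :=
    LinearPMap.domRestrict_apply rfl
  constructor
  · rintro h w
    obtain ⟨φ, hφ, hwφ⟩ := w.2.1
    have hwφ' : ((⟨w, w.2.2⟩ : (Lmax a).domain) : H a) =ᵐ[mu a] φ := hwφ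
    rw [hLcore, inner_eq_integral (Lmax_ae_eq hφ.toClassA hwφ') .rfl, inner_eq_integral hwφ .rfl]
    exact h φ hφ (hφ.toClassA.inMaxDomain hwφ')
  · intro h φ hφ hφL
    have hw := hφL.memLp.coeFn_toLp
    have hwφ := h ⟨hφL.memLp.toLp φ, ⟨φ, hφ, hw⟩, hφL.toLp_mem_domain⟩
    rwa [hLcore, inner_eq_integral (Lmax_ae_eq (u := ⟨_, hφL.toLp_mem_domain⟩) hφ.toClassA hw) .rfl,
      inner_eq_integral hw .rfl] at hwφ

theorem Lcore_isFormalAdjoint_Lmax (ha : 0 < a) : (Lcore a).IsFormalAdjoint (Lmax a) := by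
  intro w u
  obtain ⟨x, hx, hux⟩ := exists_inMaxDomain_ae_eq u
  exact isWeakSolution_iff.1
    ((hx.isWeakSolution ha).congr hux.symm (Lmax_ae_eq hx.classA hux).symm) w

theorem mem_graph_Lmax_of_forall_inner_Lcore_eq (ha : 0 < a) (u v : H a)
    (h : ∀ w : (Lcore a).domain, ⟪Lcore a w, u⟫_ℂ = ⟪(w : H a), v⟫_ℂ) :
    (u, v) ∈ (Lmax a).graph := by
  obtain ⟨x, hx, hux, hvx⟩ :=
    (isWeakSolution_iff.2 h).exists_inMaxDomain ha (Lp.memLp u) (Lp.memLp v)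
  exact hx.mem_graph_Lmax hux hvx

end Adjoint

section Triplet

variable {a : ℝ} {x : ℝ → ℂ} {bm cm bp cp : ℂ}

/-- The pair of vectors `b + i c` and `i c - b`, in terms of which the boundary condition of a
matrix `U` reads `U (b + i c) = i c - b`. -/
def boundaryData (bm cm bp cp : ℂ) : EuclideanSpace ℂ (Fin 2) × EuclideanSpace ℂ (Fin 2) :=
  (!₂[bm + Complex.I * cm, bp + Complex.I * cp], !₂[Complex.I * cm - bm, Complex.I * cp - bp])

theorem boundaryData_add (bm cm bp cp bm' cm' bp' cp' : ℂ) :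
    boundaryData (bm + bm') (cm + cm') (bp + bp') (cp + cp') =
      boundaryData bm cm bp cp + boundaryData bm' cm' bp' cp' := by
  ext i <;> fin_cases i <;> simp [boundaryData] <;> ring

theorem boundaryData_smul (k bm cm bp cp : ℂ) :
    boundaryData (k * bm) (k * cm) (k * bp) (k * cp) = k • boundaryData bm cm bp cp := by
  ext i <;> fin_cases i <;> simp [boundaryData] <;> ring

theorem boundaryData_zero : boundaryData 0 0 0 0 = 0 := by
  ext i <;> fin_cases i <;> simp [boundaryData]

theorem exists_boundaryData_eq (p : EuclideanSpace ℂ (Fin 2) × EuclideanSpace ℂ (Fin 2)) :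
    ∃ bm cm bp cp, boundaryData bm cm bp cp = p := by
  refine ⟨(p.1 0 - p.2 0) / 2, -Complex.I * (p.1 0 + p.2 0) / 2, (p.1 1 - p.2 1) / 2,
    -Complex.I * (p.1 1 + p.2 1) / 2, ?_⟩
  ext i <;> fin_cases i <;> simp [boundaryData]
  · linear_combination -(p.1 0 + p.2 0) / 2 * Complex.I_sq
  · linear_combination -(p.1 1 + p.2 1) / 2 * Complex.I_sq
  · linear_combination -(p.1 0 + p.2 0) / 2 * Complex.I_sq
  · linear_combination -(p.1 1 + p.2 1) / 2 * Complex.I_sq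

theorem inner_boundaryData_sub_inner_boundaryData (bm cm bp cp bm' cm' bp' cp' : ℂ) :
    ⟪(boundaryData bm cm bp cp).2, (boundaryData bm' cm' bp' cp').2⟫_ℂ -
        ⟪(boundaryData bm cm bp cp).1, (boundaryData bm' cm' bp' cp').1⟫_ℂ =
      -(2 * Complex.I) *
        ((conj bm * cm' - conj cm * bm') + (conj bp * cp' - conj cp * bp')) := by
  simp [boundaryData, PiLp.inner_apply, Fin.sum_univ_two]
  ring_nf

theorem boundaryCondition_iff {U : Matrix (Fin 2) (Fin 2) ℂ} :
    BoundaryCondition U bm cm bp cp ↔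
      boundaryData bm cm bp cp ∈ (Matrix.toEuclideanLin U).graph := by
  rw [LinearMap.mem_graph_iff, PiLp.ext_iff, Fin.forall_fin_two]
  refine and_congr ?_ ?_ <;>
  · simp only [boundaryData, Matrix.ofLp_toLpLin, Matrix.toLin'_apply, Matrix.mulVec_eq_sum,
      Matrix.cons_val_zero, Matrix.cons_val_one, Matrix.cons_val_fin_one, op_smul_eq_smul,
      Finset.sum_apply, Pi.smul_apply, Matrix.transpose_apply, smul_eq_mul, Fin.sum_univ_two]
    constructor <;> intro h <;> linear_combination -h

/-- The graph of the map that sends the class of a function of `𝒜` to its boundary data. -/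
def traceGraph (a : ℝ) :
    Submodule ℂ (H a × (EuclideanSpace ℂ (Fin 2) × EuclideanSpace ℂ (Fin 2))) where
  carrier := {p | ∃ x bm cm bp cp, ClassA a x ∧ p.1 =ᵐ[mu a] x ∧
    HasBoundaryValues a x bm cm bp cp ∧ p.2 = boundaryData bm cm bp cp}
  zero_mem' := ⟨0, 0, 0, 0, 0, .zero a, Lp.coeFn_zero _ _ _, .zero a, boundaryData_zero.symm⟩
  add_mem' := by
    rintro ⟨u, _⟩ ⟨v, _⟩ ⟨x, bm, cm, bp, cp, hx, hux, hxb, rfl⟩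
      ⟨y, bm', cm', bp', cp', hy, hvy, hyb, rfl⟩
    exact ⟨x + y, _, _, _, _, hx.add hy, (Lp.coeFn_add _ _).trans (hux.add hvy), hxb.add hx hy hyb,
      (boundaryData_add _ _ _ _ _ _ _ _).symm⟩
  smul_mem' := by
    rintro k ⟨u, _⟩ ⟨x, bm, cm, bp, cp, hx, hux, hxb, rfl⟩
    exact ⟨k • x, _, _, _, _, hx.smul k, (Lp.coeFn_smul _ _).trans (hux.const_smul k),
      hxb.smul k hx, (boundaryData_smul _ _ _ _ _).symm⟩

theorem graph_toLinearPMap_traceGraph (ha : 0 < a) :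
    (traceGraph a).toLinearPMap.graph = traceGraph a := by
  refine Submodule.toLinearPMap_graph_eq _ ?_
  rintro ⟨_, _⟩ ⟨x, bm, cm, bp, cp, hx, h0x, hxb, rfl⟩ rfl
  have hx0 : EqOn x 0 (Ioo (-a) a) :=
    hx.eqOn_of_ae (.zero a) (h0x.symm.trans (Lp.coeFn_zero _ _ _))
  have hx₀ : ClassA₀ a x := ⟨hx, ∅, isCompact_empty, empty_subset _, fun t ht _ => hx0 ht⟩
  obtain ⟨rfl, rfl, rfl, rfl⟩ := hasBoundaryValues_unique ha hxb hx₀.hasBoundaryValues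
  exact boundaryData_zero

theorem domain_Lmax_le_domain_traceGraph (ha : 0 < a) :
    (Lmax a).domain ≤ (traceGraph a).toLinearPMap.domain := fun u hu => by
  obtain ⟨x, hx, hux⟩ := exists_inMaxDomain_ae_eq ⟨u, hu⟩
  obtain ⟨bm, cm, bp, cp, hxb⟩ := hx.exists_hasBoundaryValues ha
  exact ⟨(u, _), ⟨x, bm, cm, bp, cp, hx.classA, hux, hxb, rfl⟩, rfl⟩

/-- The boundary data of the elements of the domain of the maximal operator. -/
def boundaryMap (ha : 0 < a) :
    (Lmax a).domain →ₗ[ℂ] EuclideanSpace ℂ (Fin 2) × EuclideanSpace ℂ (Fin 2) :=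
  (traceGraph a).toLinearPMap.toFun ∘ₗ Submodule.inclusion (domain_Lmax_le_domain_traceGraph ha)

theorem boundaryMap_eq (ha : 0 < a) {u : (Lmax a).domain} (hx : ClassA a x)
    (hux : (u : H a) =ᵐ[mu a] x) (hxb : HasBoundaryValues a x bm cm bp cp) :
    boundaryMap ha u = boundaryData bm cm bp cp := by
  have hmem : ((u : H a), boundaryData bm cm bp cp) ∈ (traceGraph a).toLinearPMap.graph := by
    rw [graph_toLinearPMap_traceGraph ha]
    exact ⟨x, bm, cm, bp, cp, hx, hux, hxb, rfl⟩
  exact ((LinearPMap.image_iff (domain_Lmax_le_domain_traceGraph ha u.2)).2 hmem).symm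

theorem surjective_boundaryMap (ha : 0 < a) : Function.Surjective (boundaryMap ha) := fun p => by
  obtain ⟨bm, cm, bp, cp, rfl⟩ := exists_boundaryData_eq p
  obtain ⟨x, hx, hxb⟩ := exists_inMaxDomain_hasBoundaryValues ha.ne' bm cm bp cp
  exact ⟨⟨_, hx.toLp_mem_domain⟩, boundaryMap_eq ha hx.classA hx.memLp.coeFn_toLp hxb⟩

theorem inner_Lmax_sub_inner_Lmax (ha : 0 < a) (u v : (Lmax a).domain) :
    ⟪Lmax a u, (v : H a)⟫_ℂ - ⟪(u : H a), Lmax a v⟫_ℂ = -(Complex.I / a) *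
      (⟪(boundaryMap ha u).2, (boundaryMap ha v).2⟫_ℂ -
        ⟪(boundaryMap ha u).1, (boundaryMap ha v).1⟫_ℂ) := by
  obtain ⟨x, hx, hux⟩ := exists_inMaxDomain_ae_eq u
  obtain ⟨y, hy, hvy⟩ := exists_inMaxDomain_ae_eq v
  obtain ⟨bm, cm, bp, cp, hxb⟩ := hx.exists_hasBoundaryValues ha
  obtain ⟨bm', cm', bp', cp', hyb⟩ := hy.exists_hasBoundaryValues ha
  rw [boundaryMap_eq ha hx.classA hux hxb, boundaryMap_eq ha hy.classA hvy hyb,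
    inner_boundaryData_sub_inner_boundaryData,
    inner_eq_integral (Lmax_ae_eq hx.classA hux) hvy,
    inner_eq_integral hux (Lmax_ae_eq hy.classA hvy), ← integral_sub,
    hx.integral_formalL_sub_eq ha hy hxb hyb]
  · linear_combination -(2 / (a : ℂ)) *
      ((conj bm * cm' - conj cm * bm') + (conj bp * cp' - conj cp * bp')) * Complex.I_sq
  · exact hx.memLp_formalL.star.integrable_mul hy.memLp
  · exact hx.memLp.star.integrable_mul hy.memLp_formalL

/-- The boundary triplet of the prolate spheroid operator. -/
def boundaryTriplet (ha : 0 < a) :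
    BoundaryTriplet (Lcore a) (Lmax a) (EuclideanSpace ℂ (Fin 2)) where
  dense_domain := dense_domain_of_maximal (mem_graph_Lmax_of_forall_inner_Lcore_eq ha)
  le := LinearPMap.domRestrict_le
  adjoint_eq := adjoint_eq_of_maximal (Lcore_isFormalAdjoint_Lmax ha)
    (mem_graph_Lmax_of_forall_inner_Lcore_eq ha)
  boundaryMap := boundaryMap ha
  surjective := surjective_boundaryMap ha
  scale := -(Complex.I / a)
  scale_ne_zero :=
    neg_ne_zero.2 (div_ne_zero Complex.I_ne_zero (Complex.ofReal_ne_zero.2 ha.ne'))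
  green := inner_Lmax_sub_inner_Lmax ha

theorem mem_boundaryDomain_iff (ha : 0 < a) {U : Matrix (Fin 2) (Fin 2) ℂ} {u : (Lmax a).domain} :
    (u : H a) ∈ boundaryDomain a U ↔
      boundaryMap ha u ∈ (Matrix.toEuclideanLin U).graph := by
  constructor
  · rintro ⟨x, hx, hux, bm, cm, bp, cp, hxb, hU⟩
    exact boundaryMap_eq ha hx hux hxb ▸ boundaryCondition_iff.1 hU
  · intro h
    obtain ⟨x, hx, hux⟩ := exists_inMaxDomain_ae_eq u
    obtain ⟨bm, cm, bp, cp, hxb⟩ := hx.exists_hasBoundaryValues ha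
    rw [boundaryMap_eq ha hx.classA hux hxb] at h
    exact ⟨x, hx.classA, hux, bm, cm, bp, cp, hxb, boundaryCondition_iff.2 h⟩

theorem LU_eq_extension (ha : 0 < a) (U : Matrix (Fin 2) (Fin 2) ℂ) :
    LU a U = (boundaryTriplet ha).extension (Matrix.toEuclideanLin U).graph :=
  le_antisymm
    (le_of_le_of_domain_le LinearPMap.domRestrict_le ((boundaryTriplet ha).extension_le _)
      fun u hu => ((boundaryTriplet ha).coe_mem_extension_domain (u := ⟨u, hu.2⟩)).2
        ((mem_boundaryDomain_iff ha).1 hu.1))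
    (le_of_le_of_domain_le ((boundaryTriplet ha).extension_le _) LinearPMap.domRestrict_le
      fun u hu => ⟨(mem_boundaryDomain_iff ha (u := ⟨u, hu.2⟩)).2
        ((boundaryTriplet ha).coe_mem_extension_domain.1 hu), hu.2⟩)

theorem toEuclideanCLM_mem_unitary_iff {U : Matrix (Fin 2) (Fin 2) ℂ} :
    Matrix.toEuclideanCLM (𝕜 := ℂ) U ∈
        unitary (EuclideanSpace ℂ (Fin 2) →L[ℂ] EuclideanSpace ℂ (Fin 2)) ↔
      U ∈ Matrix.unitaryGroup (Fin 2) ℂ := by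
  refine ⟨fun h => ?_, fun h => Unitary.map_mem _ h⟩
  have := Unitary.map_mem (Matrix.toEuclideanCLM (n := Fin 2) (𝕜 := ℂ)).symm h
  rwa [StarAlgEquiv.symm_apply_apply] at this

theorem isSelfAdjoint_LU (ha : 0 < a) {U : Matrix (Fin 2) (Fin 2) ℂ}
    (hU : U ∈ Matrix.unitaryGroup (Fin 2) ℂ) : IsSelfAdjoint (LU a U) := by
  rw [LU_eq_extension ha, ← Matrix.coe_toEuclideanCLM_eq_toEuclideanLin]
  exact (boundaryTriplet ha).isSelfAdjoint_extension_graph (toEuclideanCLM_mem_unitary_iff.2 hU)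

theorem Lmin_lt_LU (ha : 0 < a) (U : Matrix (Fin 2) (Fin 2) ℂ) : Lmin a < LU a U :=
  LU_eq_extension ha U ▸ (boundaryTriplet ha).closure_lt_extension_graph _

theorem LU_lt_Lmax (ha : 0 < a) (U : Matrix (Fin 2) (Fin 2) ℂ) : LU a U < Lmax a :=
  LU_eq_extension ha U ▸ (boundaryTriplet ha).extension_graph_lt _

theorem exists_eq_LU (ha : 0 < a) {T : H a →ₗ.[ℂ] H a} (hT : IsSelfAdjoint T)
    (hmin : Lmin a ≤ T) : ∃ U ∈ Matrix.unitaryGroup (Fin 2) ℂ, T = LU a U := by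
  obtain ⟨V, hV, rfl⟩ := (boundaryTriplet ha).exists_mem_unitary_eq_extension_graph hT
    ((Lcore a).le_closure.trans hmin)
  obtain ⟨U, rfl⟩ := EquivLike.surjective (Matrix.toEuclideanCLM (n := Fin 2) (𝕜 := ℂ)) V
  refine ⟨U, toEuclideanCLM_mem_unitary_iff.1 hV, ?_⟩
  rw [LU_eq_extension ha, Matrix.coe_toEuclideanCLM_eq_toEuclideanLin]

theorem LU_injective (ha : 0 < a) : Function.Injective (LU a) := fun U₁ U₂ h => by
  rw [LU_eq_extension ha, LU_eq_extension ha] at h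
  exact Matrix.toEuclideanLin.injective
    (graph_injective ((boundaryTriplet ha).extension_injective h))

end Triplet

theorem theorem4p1_general {a : ℝ} (ha : 0 < a) :
    (∀ U : Matrix (Fin 2) (Fin 2) ℂ,
      (IsSelfAdjoint (LU a U) ↔ U ∈ Matrix.unitaryGroup (Fin 2) ℂ) ∧
        Lmin a < LU a U ∧ LU a U < Lmax a) ∧
    (∀ T : H a →ₗ.[ℂ] H a, IsSelfAdjoint T → Lmin a ≤ T →
      ∃ U ∈ Matrix.unitaryGroup (Fin 2) ℂ, T = LU a U) ∧
    Function.Injective (LU a) := by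
  refine ⟨fun U => ⟨⟨fun hU => ?_, isSelfAdjoint_LU ha⟩, Lmin_lt_LU ha U, LU_lt_Lmax ha U⟩,
    fun T hT hmin => exists_eq_LU ha hT hmin, LU_injective ha⟩
  obtain ⟨V, hV, hUV⟩ := exists_eq_LU ha hU (Lmin_lt_LU ha U).le
  exact LU_injective ha hUV ▸ hV

end Prolate

end

theorem theorem4p1 (a : ℝ) (ha : 0 < a) :
    (∀ U ∈ Matrix.unitaryGroup (Fin 2) ℂ,
      IsSelfAdjoint (Prolate.LU a U) ∧
        Prolate.Lmin a < Prolate.LU a U ∧ Prolate.LU a U < Prolate.Lmax a) ∧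
    (∀ T : Prolate.H a →ₗ.[ℂ] Prolate.H a, IsSelfAdjoint T → Prolate.Lmin a ≤ T →
      ∃ U ∈ Matrix.unitaryGroup (Fin 2) ℂ, T = Prolate.LU a U) ∧
    (∀ U₁ ∈ Matrix.unitaryGroup (Fin 2) ℂ, ∀ U₂ ∈ Matrix.unitaryGroup (Fin 2) ℂ,
      U₁ = U₂ ↔ Prolate.LU a U₁ = Prolate.LU a U₂) := by
  obtain ⟨hLU, hext, hinj⟩ := Prolate.theorem4p1_general ha
  exact ⟨fun U hU => ⟨(hLU U).1.2 hU, (hLU U).2⟩, hext, fun _ _ _ _ => hinj.eq_iff.symm⟩
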